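/- **Setting.** Let $1\le s^*<n<d$ be integers, $\alpha\in(0,1)$, and let $\|\cdot\|$, $\|\cdot\|_1$ denote the Euclidean and $\ell_1$ norms on $\mathbb R^d$. For $\theta\in\mathbb R^d$ and $\sigma>0$ let $P_{\theta,\sigma}$ be the law of $(Y,X)\in\mathbb R\times\mathbb R^d$, where $X$ has a law $Q$ not depending on $(\theta,\sigma)$, $Y=X^\top\theta+\epsilon$, and $\epsilon\sim N(0,\sigma^2)$ is independent of $X$. Let $p_{\theta,\sigma}$ be its density with respect to a common dominating measure, e.g. $dy\otimes Q(dx)$. Let $(Y_i,X_i)_{i=1}^n$ be i.i.d. with law $P_{\theta_0,\sigma_0}$, where $\theta_0\in\mathbb R^d$ has exactly $s^*$ nonzero coordinates and $\sigma_0>0$. Given $C_1>0$, $\tau>0$ and $a,b>0$, take $\theta$ and $\sigma$ independent under the prior $\pi$: $\theta$ has Lebesgue density proportional to $\prod_{i=1}^d(\tau^2+\theta_i^2)^{-2}$ on $\{\theta:\|\theta\|_1\le C_1\}$ (and $0$ outside), and $\sigma^2$ has the inverse-Gamma distribution $IG(a,b)$, with density $\frac{b^a}{\Gamma(a)}x^{-a-1}e^{-b/x}$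 on $(0,\infty)$. The fractional posterior is $$\Pi_{n,\alpha}(d\theta,d\sigma)\propto\Big(\prod_{i=1}^n p_{\theta,\sigma}(Y_i,X_i)\Big)^{\alpha}\pi(d\theta,d\sigma),$$ and $D_\alpha(P,R)=\frac1{\alpha-1}\log\int\big(\frac{dP}{d\mu}\big)^\alpha\big(\frac{dR}{d\mu}\big)^{1-\alpha}d\mu$ (for any $\mu$ with $P,R\ll\mu$) is the $\alpha$-Rényi divergence. **Theorem.** Let $a,\sigma_{\min},\sigma_{\max}>0$. There is a constant $c>0$ depending only on $\sigma_{\min},\sigma_{\max},a$ such that the following holds for all $\alpha,n,d,s^*,Q,\theta_0,\sigma_0,C_1$ as above and all $C_{\rm x}>0$. Assume $\mathbb E\|X_1\|^2<C_{\rm x}^2$ and $(2\sigma_{\min})^{-1}<\sigma_0^2<(2\sigma_{\max})^{-1}$, put $\tau=\frac1{C_{\rm x}\sqrt{nd}}$ and $b=n^{-1/2}$, and assume $\|\theta_0\|_1\le C_1-2d\tau$. Then $$\mathbb E\Big[\int D_\alpha(P_{\theta,\sigma},P_{\theta_0,\sigma_0})\,\Pi_{n,\alpha}(d\theta,d\sigma)\Big]\le\frac{1+\alpha}{1-\alpha}\,\varepsilon_n,\qquad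 \varepsilon_n=\frac{c\,s^*}{n}\log\Big(\frac{C_{\rm x}C_1\sqrt{nd}}{s^*}\Big).$$ -/

import Mathlib

open MeasureTheory ProbabilityTheory
open scoped ENNReal NNReal

noncomputable section

namespace FracPost

/-- The rescaled measure `μ / μ(univ)`, a probability measure when `0 < μ(univ) < ∞`. -/
def normalized {S : Type*} [MeasurableSpace S] (μ : Measure S) : Measure S :=
  (μ Set.univ)⁻¹ • μ

/-- The `α`-Rényi divergence `(α - 1)⁻¹ log ∫ (dP/dμ)^α (dR/dμ)^(1-α) dμ`, `0 < α < 1`, of two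
probability measures, with the dominating measure `μ = P + R`. It is nonnegative, and it is `∞`
when the integral vanishes. -/
def renyiDiv {S : Type*} [MeasurableSpace S] (α : ℝ) (P R : Measure S) : ℝ≥0∞ :=
  (((1 / (α - 1) : ℝ) : EReal) *
    ENNReal.log (∫⁻ z, (P.rnDeriv (P + R) z) ^ α * (R.rnDeriv (P + R) z) ^ (1 - α)
      ∂(P + R))).toENNReal

/-- The `ℓ₁` norm of a vector. -/
def l1norm {d : ℕ} (θ : EuclideanSpace ℝ (Fin d)) : ℝ := ∑ i, |θ i|

/-- The number of nonzero coordinates of a vector. -/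
def l0norm {d : ℕ} (θ : EuclideanSpace ℝ (Fin d)) : ℕ := {i : Fin d | θ i ≠ 0}.ncard

/-- The law `P_{θ,σ}` of one observation `(Y, X)`, where `X` has law `Q`, `ε ∼ N(0, σ²)` is
independent of `X`, and `Y = Xᵀθ + ε`. -/
def modelLaw {d : ℕ} (Q : Measure (EuclideanSpace ℝ (Fin d)))
    (θ : EuclideanSpace ℝ (Fin d)) (σ : ℝ) : Measure (ℝ × EuclideanSpace ℝ (Fin d)) :=
  (Q.prod (gaussianReal 0 (σ ^ 2).toNNReal)).map (fun p => (inner ℝ p.1 θ + p.2, p.1))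

/-- The likelihood `∏ᵢ p_{θ,σ}(Yᵢ, Xᵢ)` of a sample, where `p_{θ,σ}(y, x)` is the density of
`P_{θ,σ}` with respect to `dy ⊗ Q(dx)`, that is, the density of `N(xᵀθ, σ²)` at `y`.
(Another dominating measure would bring in a factor that depends on the sample alone and that
cancels in the posterior.) -/
def likelihood {n d : ℕ} (z : Fin n → ℝ × EuclideanSpace ℝ (Fin d))
    (θ : EuclideanSpace ℝ (Fin d)) (σ : ℝ) : ℝ :=
  ∏ i, gaussianPDFReal (inner ℝ (z i).2 θ) (σ ^ 2).toNNReal (z i).1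

/-- The scaled Student prior on `{θ : ‖θ‖₁ ≤ C₁}`, with Lebesgue density proportional to
`∏ᵢ (τ² + θᵢ²)⁻²` there. -/
def priorTheta (d : ℕ) (C₁ τ : ℝ) : Measure (EuclideanSpace ℝ (Fin d)) :=
  normalized ((volume.restrict {θ | l1norm θ ≤ C₁}).withDensity
    (fun θ => ENNReal.ofReal (∏ i, ((τ ^ 2 + θ i ^ 2) ^ 2)⁻¹)))

/-- The inverse-Gamma distribution with shape `a` and scale `b`: Lebesgue density
`b^a / Γ(a) · x^(-a-1) · exp(-b/x)` on `(0, ∞)`. -/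
def inverseGamma (a b : ℝ) : Measure ℝ :=
  (volume.restrict (Set.Ioi 0)).withDensity
    (fun x => ENNReal.ofReal (b ^ a / Real.Gamma a * x ^ (-a - 1) * Real.exp (-b / x)))

/-- The prior on `σ`: the law of `σ > 0` when `σ² ∼ IG(a, b)`. -/
def priorSigma (a b : ℝ) : Measure ℝ := (inverseGamma a b).map Real.sqrt

/-- The joint prior on `(θ, σ)`: `θ` and `σ` are independent. -/
def prior (d : ℕ) (C₁ τ a b : ℝ) : Measure (EuclideanSpace ℝ (Fin d) × ℝ) :=
  (priorTheta d C₁ τ).prod (priorSigma a b)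

/-- The fractional posterior `Π_{n,α}(dθ, dσ) ∝ L_n(θ, σ)^α π(dθ, dσ)` for the prior `π` and the
sample `z`. -/
def fracPosterior {n d : ℕ} (α : ℝ) (π : Measure (EuclideanSpace ℝ (Fin d) × ℝ))
    (z : Fin n → ℝ × EuclideanSpace ℝ (Fin d)) : Measure (EuclideanSpace ℝ (Fin d) × ℝ) :=
  normalized (π.withDensity (fun p => ENNReal.ofReal (likelihood z p.1 p.2 ^ α)))

end FracPost

end

namespace FracPost

/-! ### The scaled Student prior -/

/-! Write `f` for the `α`-power of the sample likelihood ratio against the true parameter, `A` for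
the affinity of one observation, and `X = -n log A`, which is `n (1 - α)` times the Rényi
divergence. The sample has expectation `A ^ n` for `f`, so by Fubini `W = ∫ f e^X dπ` has
expectation at most `1` (`lintegral_lintegral_sampleRatio_le`). A tangent line of `exp` gives, for
each sample with `W` finite, `∫ X dΠ ≤ W - 1 - log Z`, where `Z = ∫ f dπ`
(`lintegral_normalized_withDensity_le`). In expectation the divergence therefore costs at most
`E[-log Z]`, up to the factor `1 / (n (1 - α))`.

To bound `Z` below, restrict to a neighbourhood `B` of the truth and apply Jensen
(`exp_average_mul_le_integral`). On `B` the log-likelihood ratio is at least a term free of the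
parameter plus a term linear in `(θ - θ₀) / σ²`. After averaging over `B` the linear term is a noise
sum against a fixed vector, and its expectation is zero. What remains is `-log π(B)` and a
Kullback–Leibler type term (`lintegral_renyiDiv_fracPosterior_le`).

Here `B` is the ball of squared radius `4dτ²` around `θ₀` times `[σ₀, σ₀ √(1 + 1/n)]`. The
Kullback–Leibler term is then bounded. The heavy Student tails make moving the prior to `θ₀` cost
only a polynomial factor per nonzero coordinate (`le_priorTheta_ball`), and the inverse-Gamma mass
is polynomial in `1/n` (`le_priorSigma_Icc`). Both logarithms are at most a constant times `s* log
(C₁ / (τ s*))`. -/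

lemma integrable_inv_sq_add_sq {τ : ℝ} (hτ : 0 < τ) :
    Integrable fun x : ℝ => (τ ^ 2 + x ^ 2)⁻¹ := by
  have h := (integrable_inv_one_add_sq.comp_mul_left' (inv_ne_zero hτ.ne')).const_mul ((τ ^ 2)⁻¹)
  refine h.congr (Filter.Eventually.of_forall fun x => ?_)
  have : 0 < τ ^ 2 + x ^ 2 := by positivity
  simp only
  rw [← mul_inv]
  congr 1
  field_simp

lemma integrable_student {τ : ℝ} (hτ : 0 < τ) :
    Integrable fun x : ℝ => ((τ ^ 2 + x ^ 2) ^ 2)⁻¹ := by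
  refine ((integrable_inv_sq_add_sq hτ).const_mul ((τ ^ 2)⁻¹)).mono'
    (by fun_prop) (Filter.Eventually.of_forall fun x => ?_)
  rw [Real.norm_of_nonneg (by positivity), sq (τ ^ 2 + x ^ 2), mul_inv]
  gcongr
  nlinarith [sq_nonneg x]

lemma integrable_sq_mul_student {τ : ℝ} (hτ : 0 < τ) :
    Integrable fun x : ℝ => x ^ 2 * ((τ ^ 2 + x ^ 2) ^ 2)⁻¹ := by
  have h := (integrable_inv_sq_add_sq hτ).sub ((integrable_student hτ).const_mul (τ ^ 2))
  refine h.congr (Filter.Eventually.of_forall fun x => ?_)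
  have : 0 < τ ^ 2 + x ^ 2 := by positivity
  simp only [Pi.sub_apply]
  field_simp
  ring

/-- The function `x / (τ² + x²)` vanishes at both infinities and has derivative `(τ² - x²) / (τ² +
x²)²`, whose integral is therefore zero. Thus the normalized density has second moment exactly `τ²`.
-/
lemma integral_sq_mul_student {τ : ℝ} (hτ : 0 < τ) :
    ∫ x : ℝ, x ^ 2 * ((τ ^ 2 + x ^ 2) ^ 2)⁻¹ = τ ^ 2 * ∫ x : ℝ, ((τ ^ 2 + x ^ 2) ^ 2)⁻¹ := by
  have hlim : ∀ l : Filter ℝ, Filter.Tendsto (fun x : ℝ => x⁻¹) l (nhds 0) →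
      (∀ᶠ x in l, x ≠ 0) →
      Filter.Tendsto (fun x : ℝ => x * (τ ^ 2 + x ^ 2)⁻¹) l (nhds 0) := by
    intro l hl h0
    refine squeeze_zero_norm' (a := fun x => |x⁻¹|) ?_ (by simpa using hl.abs)
    filter_upwards [h0] with x hx
    have : 0 < τ ^ 2 + x ^ 2 := by positivity
    have h2 : 0 < |x| := abs_pos.2 hx
    rw [Real.norm_eq_abs, abs_mul, abs_inv, abs_inv, abs_of_pos this, ← div_eq_mul_inv,
      div_le_iff₀ this, ← sq_abs x]
    have : |x|⁻¹ * |x| ^ 2 = |x| := by field_simp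
    nlinarith [mul_nonneg (inv_nonneg.2 h2.le) (sq_nonneg τ)]
  have hderiv : ∀ x : ℝ, HasDerivAt (fun x : ℝ => x * (τ ^ 2 + x ^ 2)⁻¹)
      (τ ^ 2 * ((τ ^ 2 + x ^ 2) ^ 2)⁻¹ - x ^ 2 * ((τ ^ 2 + x ^ 2) ^ 2)⁻¹) x := by
    intro x
    have hx : τ ^ 2 + x ^ 2 ≠ 0 := by positivity
    have h := (hasDerivAt_id x).mul ((((hasDerivAt_id x).pow 2).const_add (τ ^ 2)).inv hx)
    refine h.congr_deriv ?_
    simp only [Pi.pow_apply, Pi.inv_apply, id]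
    field_simp
    push_cast
    ring
  have hi := ((integrable_student hτ).const_mul (τ ^ 2)).sub (integrable_sq_mul_student hτ)
  have h := integral_of_hasDerivAt_of_tendsto hderiv hi
    (hlim _ tendsto_inv_atBot_zero (Filter.eventually_ne_atBot 0))
    (hlim _ tendsto_inv_atTop_zero (Filter.eventually_ne_atTop 0))
  rw [integral_sub ((integrable_student hτ).const_mul _) (integrable_sq_mul_student hτ),
    integral_const_mul] at h
  linarith

/-- The unnormalized product Student density. -/
noncomputable def studentProd {d : ℕ} (τ : ℝ) (u : EuclideanSpace ℝ (Fin d)) : ℝ :=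
  ∏ i, ((τ ^ 2 + u i ^ 2) ^ 2)⁻¹

lemma studentProd_nonneg {d : ℕ} (τ : ℝ) (u : EuclideanSpace ℝ (Fin d)) :
    0 ≤ studentProd τ u :=
  Finset.prod_nonneg fun _ _ => by positivity

lemma integrable_prod_coord {d : ℕ} {h : Fin d → ℝ → ℝ} (hh : ∀ i, Integrable (h i)) :
    Integrable fun u : EuclideanSpace ℝ (Fin d) => ∏ i, h i (u i) :=
  (PiLp.volume_preserving_ofLp (Fin d)).integrable_comp_of_integrable
    (Integrable.fintype_prod (𝕜 := ℝ) hh)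

lemma integral_prod_coord {d : ℕ} (h : Fin d → ℝ → ℝ) :
    ∫ u : EuclideanSpace ℝ (Fin d), ∏ i, h i (u i) = ∏ i, ∫ x, h i x := by
  rw [← integral_fintype_prod_volume_eq_prod h]
  exact (PiLp.volume_preserving_ofLp (Fin d)).integral_comp
    (MeasurableEquiv.toLp 2 (Fin d → ℝ)).symm.measurableEmbedding fun x => ∏ i, h i (x i)

lemma integrable_studentProd {d : ℕ} {τ : ℝ} (hτ : 0 < τ) :
    Integrable (studentProd τ : EuclideanSpace ℝ (Fin d) → ℝ) :=
  integrable_prod_coord fun _ => integrable_student hτ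

lemma integral_studentProd {d : ℕ} (τ : ℝ) :
    ∫ u : EuclideanSpace ℝ (Fin d), studentProd τ u
      = (∫ x : ℝ, ((τ ^ 2 + x ^ 2) ^ 2)⁻¹) ^ d := by
  unfold studentProd
  rw [integral_prod_coord fun _ x => ((τ ^ 2 + x ^ 2) ^ 2)⁻¹]
  simp

/-- Absorbing the square into the `i`-th factor keeps a product form, so that Fubini applies to
second moments. -/
lemma sq_mul_studentProd {d : ℕ} (τ : ℝ) (i : Fin d) (u : EuclideanSpace ℝ (Fin d)) :
    u i ^ 2 * studentProd τ u
      = ∏ j, (if j = i then u j ^ 2 else 1) * ((τ ^ 2 + u j ^ 2) ^ 2)⁻¹ := by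
  rw [studentProd, Finset.prod_mul_distrib]
  simp

lemma integrable_sq_mul_studentProd {d : ℕ} {τ : ℝ} (hτ : 0 < τ) (i : Fin d) :
    Integrable fun u : EuclideanSpace ℝ (Fin d) => u i ^ 2 * studentProd τ u := by
  simp_rw [sq_mul_studentProd]
  refine integrable_prod_coord
    (h := fun j x => (if j = i then x ^ 2 else 1) * ((τ ^ 2 + x ^ 2) ^ 2)⁻¹) fun j => ?_
  by_cases hj : j = i
  · simpa [hj] using integrable_sq_mul_student hτ
  · simpa [hj] using integrable_student hτ

lemma integral_sq_mul_studentProd {d : ℕ} {τ : ℝ} (hτ : 0 < τ) (i : Fin d) :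
    ∫ u : EuclideanSpace ℝ (Fin d), u i ^ 2 * studentProd τ u
      = τ ^ 2 * ∫ u : EuclideanSpace ℝ (Fin d), studentProd τ u := by
  simp_rw [sq_mul_studentProd]
  rw [integral_prod_coord fun j x => (if j = i then x ^ 2 else 1) * ((τ ^ 2 + x ^ 2) ^ 2)⁻¹,
    integral_studentProd]
  have : ∀ j, ∫ x : ℝ, (if j = i then x ^ 2 else 1) * ((τ ^ 2 + x ^ 2) ^ 2)⁻¹
      = (if j = i then τ ^ 2 else 1) * ∫ x : ℝ, ((τ ^ 2 + x ^ 2) ^ 2)⁻¹ := by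
    intro j
    by_cases hj : j = i
    · simpa [hj] using integral_sq_mul_student hτ
    · simp [hj]
  simp_rw [this, Finset.prod_mul_distrib]
  simp

/-- Markov's inequality: the normalized density has `E‖u‖² = dτ²`, and the indicator of the ball
dominates `1 - ‖u‖² / (4dτ²)`. -/
lemma studentProd_mass_ball {d : ℕ} {τ : ℝ} (hτ : 0 < τ) (hd : 0 < d) :
    3 / 4 * ∫ u : EuclideanSpace ℝ (Fin d), studentProd τ u
      ≤ ∫ u in {u : EuclideanSpace ℝ (Fin d) | ‖u‖ ^ 2 ≤ 4 * d * τ ^ 2}, studentProd τ u := by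
  have hd' : (0 : ℝ) < d := by exact_mod_cast hd
  have hm : MeasurableSet {u : EuclideanSpace ℝ (Fin d) | ‖u‖ ^ 2 ≤ 4 * d * τ ^ 2} :=
    measurableSet_le (by fun_prop) (by fun_prop)
  have hs : Integrable fun u : EuclideanSpace ℝ (Fin d) => ∑ i, u i ^ 2 * studentProd τ u :=
    integrable_finsetSum _ fun i _ => integrable_sq_mul_studentProd hτ i
  have e : ∫ u : EuclideanSpace ℝ (Fin d),
      (studentProd τ u - (4 * d * τ ^ 2)⁻¹ * ∑ i, u i ^ 2 * studentProd τ u)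
      = 3 / 4 * ∫ u : EuclideanSpace ℝ (Fin d), studentProd τ u := by
    rw [integral_sub (integrable_studentProd hτ) (hs.const_mul _), integral_const_mul,
      integral_finsetSum _ fun i _ => integrable_sq_mul_studentProd hτ i]
    simp_rw [integral_sq_mul_studentProd hτ]
    simp
    field_simp
    ring
  rw [← e, ← integral_indicator hm]
  refine integral_mono ((integrable_studentProd hτ).sub (hs.const_mul _))
    ((integrable_studentProd hτ).indicator hm) fun u => ?_
  have h0 := studentProd_nonneg τ u
  simp only
  rw [← Finset.sum_mul]
  have hn : ∑ i, u i ^ 2 = ‖u‖ ^ 2 := (EuclideanSpace.real_norm_sq_eq u).symm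
  rw [hn]
  by_cases hu : ‖u‖ ^ 2 ≤ 4 * d * τ ^ 2
  · rw [Set.indicator_of_mem (by exact hu)]
    have : 0 ≤ (4 * d * τ ^ 2)⁻¹ * (‖u‖ ^ 2 * studentProd τ u) := by positivity
    linarith
  · rw [Set.indicator_of_notMem (by exact hu)]
    push Not at hu
    have : 1 ≤ (4 * d * τ ^ 2)⁻¹ * ‖u‖ ^ 2 := by
      rw [inv_mul_eq_div, le_div_iff₀ (by positivity)]; linarith
    nlinarith

/-- Polynomial tails: a shift by `t` inflates `τ² + x²` by at most `2 (1 + |t|/τ)²`. -/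
lemma student_shift {τ : ℝ} (hτ : 0 < τ) (x t : ℝ) :
    ((2 * (1 + |t| / τ) ^ 2) ^ 2)⁻¹ * ((τ ^ 2 + x ^ 2) ^ 2)⁻¹ ≤ ((τ ^ 2 + (x + t) ^ 2) ^ 2)⁻¹ := by
  rw [← mul_inv, ← mul_pow]
  have ht : 0 ≤ |t| / τ := by positivity
  have h1 : τ ^ 2 * (|t| / τ) ^ 2 = t ^ 2 := by rw [div_pow, sq_abs]; field_simp
  have h2 : 0 ≤ x ^ 2 * (|t| / τ) ^ 2 := by positivity
  have h3 : 0 ≤ (τ ^ 2 + x ^ 2) * (|t| / τ) := by positivity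
  gcongr
  nlinarith [sq_nonneg (x - t)]

lemma studentProd_shift {d : ℕ} {τ : ℝ} (hτ : 0 < τ) (u t : EuclideanSpace ℝ (Fin d)) :
    (∏ i with t i ≠ 0, ((2 * (1 + |t i| / τ) ^ 2) ^ 2)⁻¹) * studentProd τ u
      ≤ studentProd τ (u + t) := by
  unfold studentProd
  rw [Finset.prod_filter, ← Finset.prod_mul_distrib]
  refine Finset.prod_le_prod (fun i _ => ?_) fun i _ => ?_
  · split_ifs <;> positivity
  · split_ifs with h
    · exact student_shift hτ _ _
    · rw [not_not] at h
      simp [h]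

lemma l1norm_le_sqrt_mul_norm {d : ℕ} (u : EuclideanSpace ℝ (Fin d)) :
    l1norm u ≤ √d * ‖u‖ := by
  refine Real.le_sqrt_of_sq_le ?_ |>.trans_eq (?_ : √(d * ‖u‖ ^ 2) = _)
  · have := sq_sum_le_card_mul_sum_sq (s := Finset.univ) (f := fun i => |u i|)
    simpa [l1norm, EuclideanSpace.real_norm_sq_eq] using this
  · rw [Real.sqrt_mul (by positivity), Real.sqrt_sq (norm_nonneg _)]

lemma l1norm_add_le {d : ℕ} (u v : EuclideanSpace ℝ (Fin d)) :
    l1norm (u + v) ≤ l1norm u + l1norm v := by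
  unfold l1norm
  rw [← Finset.sum_add_distrib]
  exact Finset.sum_le_sum fun i _ => abs_add_le _ _

lemma normalized_univ_le {S : Type*} [MeasurableSpace S] (μ : Measure S) :
    normalized μ Set.univ ≤ 1 := by
  simp [normalized, ENNReal.inv_mul_le_one]

/-- Translate the ball to the origin: `studentProd_shift` charges only the support of `θ₀`, and
`studentProd_mass_ball` supplies the `3 / 4`. -/
lemma le_priorTheta_ball {d : ℕ} {C₁ τ : ℝ} (hτ : 0 < τ) (hd : 0 < d)
    (θ₀ : EuclideanSpace ℝ (Fin d)) (hC : l1norm θ₀ ≤ C₁ - 2 * d * τ) :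
    ENNReal.ofReal (3 / 4 * ∏ i with θ₀ i ≠ 0, ((2 * (1 + |θ₀ i| / τ) ^ 2) ^ 2)⁻¹)
      ≤ priorTheta d C₁ τ {θ | ‖θ - θ₀‖ ^ 2 ≤ 4 * d * τ ^ 2} := by
  set r : ℝ := ∏ i with θ₀ i ≠ 0, ((2 * (1 + |θ₀ i| / τ) ^ 2) ^ 2)⁻¹ with hr
  have hr0 : 0 ≤ r := Finset.prod_nonneg fun _ _ => by positivity
  have hd' : (0 : ℝ) < d := by exact_mod_cast hd
  set S : Set (EuclideanSpace ℝ (Fin d)) := {θ | l1norm θ ≤ C₁} with hS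
  set B : Set (EuclideanSpace ℝ (Fin d)) := {θ | ‖θ - θ₀‖ ^ 2 ≤ 4 * d * τ ^ 2} with hB
  have hBm : MeasurableSet B := measurableSet_le (by fun_prop) (by fun_prop)
  -- By Cauchy–Schwarz the ball has `ℓ₁` radius at most `√d · 2√d τ = 2dτ`, the margin left by `hC`;
  -- the truncation does not cut it.
  have hBS : B ⊆ S := by
    intro θ hθ
    have h1 : ‖θ - θ₀‖ ≤ 2 * (√d * τ) := by
      refine le_of_sq_le_sq ?_ (by positivity)
      rw [mul_pow, mul_pow, Real.sq_sqrt hd'.le]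
      have : ‖θ - θ₀‖ ^ 2 ≤ 4 * d * τ ^ 2 := hθ
      linarith
    have h2 := l1norm_le_sqrt_mul_norm (θ - θ₀)
    have h3 := l1norm_add_le (θ - θ₀) θ₀
    rw [sub_add_cancel] at h3
    have h4 : √(d : ℝ) * ‖θ - θ₀‖ ≤ √d * (2 * (√d * τ)) := by gcongr
    have h5 : √(d : ℝ) * (2 * (√d * τ)) = 2 * d * τ := by
      nlinarith [Real.mul_self_sqrt hd'.le]
    show l1norm θ ≤ C₁
    linarith
  set J := ∫ u : EuclideanSpace ℝ (Fin d), studentProd τ u with hJ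
  have hint := integrable_studentProd (d := d) hτ
  -- Truncation only lowers the normalizing constant, so the full integral `J` may replace it in a
  -- lower bound.
  have htot : ((volume.restrict S).withDensity fun θ => ENNReal.ofReal (studentProd τ θ)) Set.univ
      ≤ ENNReal.ofReal J := by
    rw [withDensity_apply _ MeasurableSet.univ, Measure.restrict_univ, hJ,
      ofReal_integral_eq_lintegral_ofReal hint (Filter.Eventually.of_forall (studentProd_nonneg τ))]
    exact lintegral_mono' Measure.restrict_le_self le_rfl
  have hball : 3 / 4 * r * J ≤ ∫ θ in B, studentProd τ θ := by
    have h1 : ∫ θ in B, studentProd τ θ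
        = ∫ u in {u : EuclideanSpace ℝ (Fin d) | ‖u‖ ^ 2 ≤ 4 * d * τ ^ 2},
            studentProd τ (u + θ₀) := by
      rw [← (measurePreserving_add_right volume θ₀).setIntegral_preimage_emb
        (measurableEmbedding_addRight θ₀)]
      simp [hB]
    rw [h1]
    calc 3 / 4 * r * J = r * (3 / 4 * J) := by ring
      _ ≤ r * ∫ u in {u : EuclideanSpace ℝ (Fin d) | ‖u‖ ^ 2 ≤ 4 * d * τ ^ 2}, studentProd τ u := by
        gcongr; exact studentProd_mass_ball hτ hd
      _ ≤ _ := by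
        rw [← integral_const_mul]
        exact setIntegral_mono (hint.integrableOn.const_mul _)
          ((hint.comp_add_right θ₀).integrableOn) fun u => studentProd_shift hτ u θ₀
  have hmass : ENNReal.ofReal (3 / 4 * r * J) ≤
      ((volume.restrict S).withDensity fun θ => ENNReal.ofReal (studentProd τ θ)) B := by
    rw [withDensity_apply _ hBm, Measure.restrict_restrict hBm, Set.inter_eq_left.2 hBS,
      ← ofReal_integral_eq_lintegral_ofReal hint.integrableOn
        (Filter.Eventually.of_forall (studentProd_nonneg τ))]
    exact ENNReal.ofReal_le_ofReal hball
  have hJpos : 0 < J := by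
    refine (integral_pos_iff_support_of_nonneg (studentProd_nonneg τ) hint).2 ?_
    have : Function.support (studentProd τ : EuclideanSpace ℝ (Fin d) → ℝ) = Set.univ := by
      ext u
      have : studentProd τ u ≠ 0 := Finset.prod_ne_zero_iff.2 fun i _ => by positivity
      simpa using this
    rw [this]
    exact isOpen_univ.measure_pos volume Set.univ_nonempty
  rw [priorTheta, normalized, Measure.smul_apply, smul_eq_mul]
  change _ ≤ (((volume.restrict S).withDensity fun θ => ENNReal.ofReal (studentProd τ θ)) _)⁻¹ *
    ((volume.restrict S).withDensity fun θ => ENNReal.ofReal (studentProd τ θ)) B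
  calc ENNReal.ofReal (3 / 4 * r)
      = (ENNReal.ofReal J)⁻¹ * ENNReal.ofReal (3 / 4 * r * J) := by
        rw [ENNReal.ofReal_mul (by positivity : 0 ≤ 3 / 4 * r), mul_left_comm,
          ENNReal.inv_mul_cancel (by simpa using hJpos) ENNReal.ofReal_ne_top, mul_one]
    _ ≤ _ := by gcongr

/-! ### The inverse-Gamma prior -/

/-- The substitution `x ↦ x⁻¹` turns the density into the Gamma density. Only total mass at most one
is ever needed. -/
lemma inverseGamma_univ_le {a b : ℝ} (ha : 0 < a) (hb : 0 < b) :
    inverseGamma a b Set.univ ≤ 1 := by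
  have himg : (fun x : ℝ => x⁻¹) '' Set.Ioi 0 = Set.Ioi 0 := by
    ext x
    constructor
    · rintro ⟨y, hy, rfl⟩; exact inv_pos.2 (Set.mem_Ioi.1 hy)
    · exact fun hx => ⟨x⁻¹, Set.mem_Ioi.2 (inv_pos.2 hx), inv_inv x⟩
  have h := lintegral_image_eq_lintegral_abs_deriv_mul (s := Set.Ioi (0 : ℝ)) measurableSet_Ioi
    (fun x hx => (hasDerivAt_inv (ne_of_gt hx)).hasDerivWithinAt) inv_injective.injOn
    (gammaPDF a b)
  rw [himg] at h
  rw [inverseGamma, withDensity_apply _ MeasurableSet.univ, Measure.restrict_univ,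
    ← lintegral_gammaPDF_eq_one ha hb]
  refine le_trans (le_of_eq ?_) (h.symm.le.trans (setLIntegral_le_lintegral _ _))
  refine setLIntegral_congr_fun measurableSet_Ioi fun x hx => ?_
  have hx' : 0 < x := hx
  rw [gammaPDF_of_nonneg (inv_pos.2 hx').le, ← ENNReal.ofReal_mul (abs_nonneg _)]
  congr 1
  rw [abs_neg, abs_of_pos (by positivity), Real.inv_rpow hx'.le, ← Real.rpow_neg hx'.le,
    ← div_eq_mul_inv, ← neg_div,
    show -a - 1 = -(a - 1) + (-2 : ℝ) by ring, Real.rpow_add hx', Real.rpow_neg hx'.le 2,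
    Real.rpow_two]
  ring

lemma priorSigma_univ_le {a b : ℝ} (ha : 0 < a) (hb : 0 < b) :
    priorSigma a b Set.univ ≤ 1 := by
  rw [priorSigma, Measure.map_apply (by fun_prop) MeasurableSet.univ]
  exact inverseGamma_univ_le ha hb

lemma priorSigma_ae_pos (a b : ℝ) : ∀ᵐ σ ∂priorSigma a b, 0 < σ := by
  rw [priorSigma, ae_map_iff (by fun_prop) measurableSet_Ioi]
  refine (withDensity_absolutelyContinuous _ _).ae_le ?_
  filter_upwards [ae_restrict_mem measurableSet_Ioi] with x hx
  exact Real.sqrt_pos.2 hx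

/-- On `[s², t²]` the power of the density is smallest at the right end and the exponential at the
left end. -/
lemma le_priorSigma_Icc {a b s t : ℝ} (ha : 0 < a) (hb : 0 < b) (hs : 0 < s) (hst : s ≤ t) :
    ENNReal.ofReal (b ^ a / Real.Gamma a * (t ^ 2) ^ (-a - 1) * Real.exp (-b / s ^ 2)
      * (t ^ 2 - s ^ 2)) ≤ priorSigma a b (Set.Icc s t) := by
  have hΓ := Real.Gamma_pos_of_pos ha
  have hs2 : 0 < s ^ 2 := by positivity
  have hsub : Set.Icc (s ^ 2) (t ^ 2) ⊆ Real.sqrt ⁻¹' Set.Icc s t := fun x hx =>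
    ⟨Real.le_sqrt_of_sq_le hx.1, Real.sqrt_le_iff.2 ⟨hs.le.trans hst, hx.2⟩⟩
  rw [priorSigma, Measure.map_apply (by fun_prop) measurableSet_Icc]
  refine le_trans ?_ (measure_mono hsub)
  have hpos : Set.Icc (s ^ 2) (t ^ 2) ⊆ Set.Ioi 0 := fun x hx => hs2.trans_le hx.1
  rw [inverseGamma, withDensity_apply _ measurableSet_Icc,
    Measure.restrict_restrict measurableSet_Icc, Set.inter_eq_left.2 hpos,
    ENNReal.ofReal_mul (by positivity), ← Real.volume_Icc, ← setLIntegral_const]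
  refine setLIntegral_mono' measurableSet_Icc fun x hx => ENNReal.ofReal_le_ofReal ?_
  have hx0 : 0 < x := hpos hx
  have h1 : (t ^ 2) ^ (-a - 1) ≤ x ^ (-a - 1) :=
    Real.rpow_le_rpow_of_nonpos hx0 hx.2 (by linarith)
  have h2 : -b / s ^ 2 ≤ -b / x := by
    rw [neg_div, neg_div, neg_le_neg_iff]
    exact div_le_div_of_nonneg_left hb.le hs2 hx.1
  gcongr

/-! ### Rényi divergence of a measure from a base measure -/

/-- Against `P + ν`, of density `q + 1` over `ν`, the two derivatives are `q / (q + 1)` and `1 / (q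
+ 1)`; the powers of `q + 1` cancel in the integral. -/
lemma renyiDiv_withDensity {S : Type*} [MeasurableSpace S] {α : ℝ} (hα1 : α < 1)
    (ν : Measure S) [IsFiniteMeasure ν] {q : S → ℝ} (hq : Measurable q)
    (hqpos : ∀ z, 0 < q z) [IsFiniteMeasure (ν.withDensity fun z => ENNReal.ofReal (q z))]
    {A : ℝ} (hA : 0 < A) (hAq : ∫⁻ z, ENNReal.ofReal (q z ^ α) ∂ν = ENNReal.ofReal A) :
    renyiDiv α (ν.withDensity fun z => ENNReal.ofReal (q z)) ν
      = ENNReal.ofReal (-Real.log A / (1 - α)) := by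
  set P := ν.withDensity fun z => ENNReal.ofReal (q z) with hPdef
  have hadd : P + ν = ν.withDensity fun z => ENNReal.ofReal (q z + 1) := by
    have h1 : ν = ν.withDensity fun _ => 1 := by simp
    conv_lhs => rw [h1, hPdef]
    rw [← withDensity_add_left (by fun_prop)]
    congr 1
    ext z
    simp [ENNReal.ofReal_add (hqpos z).le zero_le_one]
  have hP' : P = (P + ν).withDensity fun z => ENNReal.ofReal (q z / (q z + 1)) := by
    rw [hadd, ← withDensity_mul _ (by fun_prop) (by fun_prop), hPdef]
    congr 1
    ext z
    have := hqpos z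
    rw [Pi.mul_apply, ← ENNReal.ofReal_mul (by positivity)]
    congr 1
    field_simp
  have hR' : ν = (P + ν).withDensity fun z => ENNReal.ofReal (1 / (q z + 1)) := by
    rw [hadd, ← withDensity_mul _ (by fun_prop) (by fun_prop)]
    conv_lhs => rw [← withDensity_one (μ := ν)]
    congr 1
    ext z
    have := hqpos z
    rw [Pi.mul_apply, ← ENNReal.ofReal_mul (by positivity), Pi.one_apply, ← ENNReal.ofReal_one]
    congr 1
    field_simp
  have h1 : P.rnDeriv (P + ν) =ᵐ[P + ν] fun z => ENNReal.ofReal (q z / (q z + 1)) := by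
    have := Measure.rnDeriv_withDensity (P + ν)
      (f := fun z => ENNReal.ofReal (q z / (q z + 1))) (by fun_prop)
    rwa [← hP'] at this
  have h2 : ν.rnDeriv (P + ν) =ᵐ[P + ν] fun z => ENNReal.ofReal (1 / (q z + 1)) := by
    have := Measure.rnDeriv_withDensity (P + ν)
      (f := fun z => ENNReal.ofReal (1 / (q z + 1))) (by fun_prop)
    rwa [← hR'] at this
  have hint : ∫⁻ z, (P.rnDeriv (P + ν) z) ^ α * (ν.rnDeriv (P + ν) z) ^ (1 - α) ∂(P + ν)
      = ENNReal.ofReal A := by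
    have e1 : ∫⁻ z, (P.rnDeriv (P + ν) z) ^ α * (ν.rnDeriv (P + ν) z) ^ (1 - α) ∂(P + ν)
        = ∫⁻ z, ENNReal.ofReal ((q z / (q z + 1)) ^ α * (1 / (q z + 1)) ^ (1 - α)) ∂(P + ν) := by
      refine lintegral_congr_ae ?_
      filter_upwards [h1, h2] with z hz1 hz2
      have := hqpos z
      rw [hz1, hz2, ENNReal.ofReal_rpow_of_pos (by positivity),
        ENNReal.ofReal_rpow_of_pos (by positivity), ENNReal.ofReal_mul (by positivity)]
    rw [e1, hadd, lintegral_withDensity_eq_lintegral_mul _ (by fun_prop) (by fun_prop), ← hAq]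
    refine lintegral_congr fun z => ?_
    have := hqpos z
    rw [Pi.mul_apply, ← ENNReal.ofReal_mul (by positivity)]
    congr 1
    have h3 : 0 < q z + 1 := by positivity
    rw [Real.div_rpow this.le h3.le, Real.div_rpow zero_le_one h3.le, Real.one_rpow,
      Real.rpow_sub h3, Real.rpow_one]
    have := Real.rpow_pos_of_pos h3 α
    field_simp
  rw [renyiDiv, hint, ENNReal.log_ofReal_of_pos hA, ← EReal.coe_mul,
    EReal.toENNReal_of_ne_top (EReal.coe_ne_top _), EReal.toReal_coe]
  congr 1
  have : α - 1 ≠ 0 := by linarith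
  have : 1 - α ≠ 0 := by linarith
  field_simp
  ring

/-! ### The Gaussian regression model -/

section Model

variable {d : ℕ}

/-- The density of `P_{θ,σ}` with respect to `dy ⊗ Q(dx)`. -/
noncomputable def modelDensity (z : ℝ × EuclideanSpace ℝ (Fin d))
    (p : EuclideanSpace ℝ (Fin d) × ℝ) : ℝ :=
  gaussianPDFReal (inner ℝ z.2 p.1) (p.2 ^ 2).toNNReal z.1

lemma measurable_modelDensity :
    Measurable fun w : (ℝ × EuclideanSpace ℝ (Fin d)) × (EuclideanSpace ℝ (Fin d) × ℝ) =>
      modelDensity w.1 w.2 :=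
  measurable_uncurry_gaussianPDFReal.comp
    (f := fun w : (ℝ × EuclideanSpace ℝ (Fin d)) × (EuclideanSpace ℝ (Fin d) × ℝ) =>
      (inner ℝ w.1.2 w.2.1, (w.2.2 ^ 2).toNNReal, w.1.1)) (by fun_prop)

lemma measurable_modelDensity_left (p : EuclideanSpace ℝ (Fin d) × ℝ) :
    Measurable fun z => modelDensity z p :=
  measurable_modelDensity.comp (f := fun z => (z, p)) (by fun_prop)

lemma toNNReal_sq_ne_zero {σ : ℝ} (hσ : 0 < σ) : (σ ^ 2).toNNReal ≠ 0 := by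
  simpa using hσ.ne'

lemma modelDensity_pos {p : EuclideanSpace ℝ (Fin d) × ℝ} (hp : 0 < p.2)
    (z : ℝ × EuclideanSpace ℝ (Fin d)) : 0 < modelDensity z p :=
  gaussianPDFReal_pos _ _ _ (toNNReal_sq_ne_zero hp)

lemma modelDensity_nonneg (p : EuclideanSpace ℝ (Fin d) × ℝ)
    (z : ℝ × EuclideanSpace ℝ (Fin d)) : 0 ≤ modelDensity z p :=
  gaussianPDFReal_nonneg _ _ _

variable (Q : Measure (EuclideanSpace ℝ (Fin d))) [IsProbabilityMeasure Q]

instance isProbabilityMeasure_modelLaw (θ : EuclideanSpace ℝ (Fin d)) (σ : ℝ) :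
    IsProbabilityMeasure (modelLaw Q θ σ) :=
  Measure.isProbabilityMeasure_map (by fun_prop)

lemma modelLaw_eq_withDensity (θ : EuclideanSpace ℝ (Fin d)) {σ : ℝ} (hσ : 0 < σ) :
    modelLaw Q θ σ = ((volume : Measure ℝ).prod Q).withDensity
      fun z => ENNReal.ofReal (modelDensity z (θ, σ)) := by
  have hm := (measurable_modelDensity_left (θ, σ)).ennreal_ofReal
  refine Measure.ext_of_lintegral _ fun F hF => ?_
  rw [lintegral_withDensity_eq_lintegral_mul _ hm hF,
    lintegral_prod_symm _ (hm.mul hF).aemeasurable, modelLaw,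
    lintegral_map hF (by fun_prop), lintegral_prod _ (by fun_prop)]
  refine lintegral_congr fun x => ?_
  have h := gaussianReal_map_const_add (μ := 0) (v := (σ ^ 2).toNNReal) (inner ℝ x θ)
  rw [zero_add] at h
  have hFx : Measurable fun y => F (y, x) := by fun_prop
  have h2 := lintegral_map (μ := gaussianReal 0 (σ ^ 2).toNNReal) hFx
    (g := fun e => inner ℝ x θ + e) (by fun_prop)
  simp only
  rw [← h2, h, gaussianReal_of_var_ne_zero _ (toNNReal_sq_ne_zero hσ),
    lintegral_withDensity_eq_lintegral_mul _ (measurable_gaussianPDF _ _) hFx]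
  rfl

/-- The likelihood ratio of one observation against the reference parameter `p₀`. -/
noncomputable def ratio (p₀ : EuclideanSpace ℝ (Fin d) × ℝ) (z : ℝ × EuclideanSpace ℝ (Fin d))
    (p : EuclideanSpace ℝ (Fin d) × ℝ) : ℝ :=
  modelDensity z p / modelDensity z p₀

variable {p₀ : EuclideanSpace ℝ (Fin d) × ℝ}

lemma measurable_ratio :
    Measurable fun w : (ℝ × EuclideanSpace ℝ (Fin d)) × (EuclideanSpace ℝ (Fin d) × ℝ) =>
      ratio p₀ w.1 w.2 :=
  measurable_modelDensity.div ((measurable_modelDensity_left p₀).comp measurable_fst)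

lemma measurable_ratio_left (p : EuclideanSpace ℝ (Fin d) × ℝ) :
    Measurable fun z => ratio p₀ z p :=
  measurable_ratio.comp (f := fun z => (z, p)) (by fun_prop)

lemma ratio_nonneg (z : ℝ × EuclideanSpace ℝ (Fin d)) (p : EuclideanSpace ℝ (Fin d) × ℝ) :
    0 ≤ ratio p₀ z p :=
  div_nonneg (modelDensity_nonneg _ _) (modelDensity_nonneg _ _)

lemma ratio_pos (h₀ : 0 < p₀.2) {p : EuclideanSpace ℝ (Fin d) × ℝ} (hp : 0 < p.2)
    (z : ℝ × EuclideanSpace ℝ (Fin d)) : 0 < ratio p₀ z p :=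
  div_pos (modelDensity_pos hp _) (modelDensity_pos h₀ _)

lemma modelLaw_eq_withDensity_ratio (h₀ : 0 < p₀.2) {p : EuclideanSpace ℝ (Fin d) × ℝ}
    (hp : 0 < p.2) :
    modelLaw Q p.1 p.2
      = (modelLaw Q p₀.1 p₀.2).withDensity fun z => ENNReal.ofReal (ratio p₀ z p) := by
  rw [modelLaw_eq_withDensity Q _ hp, modelLaw_eq_withDensity Q _ h₀,
    ← withDensity_mul _ (measurable_modelDensity_left _).ennreal_ofReal
      (measurable_ratio_left _).ennreal_ofReal]
  congr 1
  ext z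
  have := modelDensity_pos h₀ z
  rw [Pi.mul_apply, ← ENNReal.ofReal_mul this.le, ratio, mul_div_cancel₀ _ this.ne']

/-- The affinity `∫ p_{θ,σ}^α p_{θ₀,σ₀}^(1-α)`. -/
noncomputable def affinity (α : ℝ) (p₀ p : EuclideanSpace ℝ (Fin d) × ℝ) : ℝ :=
  (∫⁻ z, ENNReal.ofReal (ratio p₀ z p ^ α) ∂modelLaw Q p₀.1 p₀.2).toReal

lemma measurable_ratio_rpow (α : ℝ) :
    Measurable fun w : (ℝ × EuclideanSpace ℝ (Fin d)) × (EuclideanSpace ℝ (Fin d) × ℝ) =>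
      ENNReal.ofReal (ratio p₀ w.1 w.2 ^ α) :=
  (measurable_ratio.pow_const α).ennreal_ofReal

lemma measurable_affinity (α : ℝ) : Measurable (affinity Q α p₀) :=
  (Measurable.lintegral_prod_left' (measurable_ratio_rpow α)).ennreal_toReal

variable {α : ℝ}

/-- Weighted AM–GM gives `r ^ α ≤ (1 - α) + α r`, and the likelihood ratio has mean one. -/
lemma lintegral_ratio_rpow_le (hα0 : 0 < α) (hα1 : α < 1) (h₀ : 0 < p₀.2)
    {p : EuclideanSpace ℝ (Fin d) × ℝ} (hp : 0 < p.2) :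
    ∫⁻ z, ENNReal.ofReal (ratio p₀ z p ^ α) ∂modelLaw Q p₀.1 p₀.2 ≤ 1 := by
  have h1 : ∫⁻ z, ENNReal.ofReal (ratio p₀ z p) ∂modelLaw Q p₀.1 p₀.2 = 1 := by
    have := measure_univ (μ := modelLaw Q p.1 p.2)
    rwa [modelLaw_eq_withDensity_ratio Q h₀ hp, withDensity_apply _ MeasurableSet.univ,
      Measure.restrict_univ] at this
  have hpt : ∀ z, ENNReal.ofReal (ratio p₀ z p ^ α)
      ≤ ENNReal.ofReal (1 - α) + ENNReal.ofReal α * ENNReal.ofReal (ratio p₀ z p) := by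
    intro z
    have hr := ratio_nonneg (p₀ := p₀) z p
    rw [← ENNReal.ofReal_mul hα0.le, ← ENNReal.ofReal_add (by linarith) (by positivity)]
    refine ENNReal.ofReal_le_ofReal ?_
    have := Real.geom_mean_le_arith_mean2_weighted (w₁ := 1 - α) (w₂ := α) (p₁ := 1)
      (p₂ := ratio p₀ z p) (by linarith) hα0.le zero_le_one hr (by ring)
    simpa using this
  calc _ ≤ ∫⁻ z, (ENNReal.ofReal (1 - α) + ENNReal.ofReal α * ENNReal.ofReal (ratio p₀ z p))
        ∂modelLaw Q p₀.1 p₀.2 := lintegral_mono hpt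
    _ = 1 := by
      rw [lintegral_add_left (by fun_prop), lintegral_const_mul _
        (measurable_ratio_left _).ennreal_ofReal, h1, lintegral_const, measure_univ, mul_one,
        mul_one, ← ENNReal.ofReal_add (by linarith) hα0.le]
      simp

lemma ofReal_affinity (hα0 : 0 < α) (hα1 : α < 1) (h₀ : 0 < p₀.2)
    {p : EuclideanSpace ℝ (Fin d) × ℝ} (hp : 0 < p.2) :
    ∫⁻ z, ENNReal.ofReal (ratio p₀ z p ^ α) ∂modelLaw Q p₀.1 p₀.2
      = ENNReal.ofReal (affinity Q α p₀ p) :=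
  (ENNReal.ofReal_toReal
    (ne_top_of_le_ne_top ENNReal.one_ne_top (lintegral_ratio_rpow_le Q hα0 hα1 h₀ hp))).symm

lemma affinity_le_one (hα0 : 0 < α) (hα1 : α < 1) (h₀ : 0 < p₀.2)
    {p : EuclideanSpace ℝ (Fin d) × ℝ} (hp : 0 < p.2) : affinity Q α p₀ p ≤ 1 :=
  ENNReal.toReal_le_of_le_ofReal zero_le_one
    (by simpa using lintegral_ratio_rpow_le Q hα0 hα1 h₀ hp)

lemma affinity_pos (hα0 : 0 < α) (hα1 : α < 1) (h₀ : 0 < p₀.2)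
    {p : EuclideanSpace ℝ (Fin d) × ℝ} (hp : 0 < p.2) : 0 < affinity Q α p₀ p := by
  refine ENNReal.toReal_pos ?_
    (ne_top_of_le_ne_top ENNReal.one_ne_top (lintegral_ratio_rpow_le Q hα0 hα1 h₀ hp))
  refine ((lintegral_pos_iff_support
    ((measurable_ratio_left p).pow_const α).ennreal_ofReal).2 ?_).ne'
  have : Function.support (fun z => ENNReal.ofReal (ratio p₀ z p ^ α)) = Set.univ := by
    ext z
    have := Real.rpow_pos_of_pos (ratio_pos h₀ hp z) α
    simpa using this
  rw [this, measure_univ]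
  exact one_pos

lemma renyiDiv_modelLaw (hα0 : 0 < α) (hα1 : α < 1) (h₀ : 0 < p₀.2)
    {p : EuclideanSpace ℝ (Fin d) × ℝ} (hp : 0 < p.2) :
    renyiDiv α (modelLaw Q p.1 p.2) (modelLaw Q p₀.1 p₀.2)
      = ENNReal.ofReal (-Real.log (affinity Q α p₀ p) / (1 - α)) := by
  have hfin : IsFiniteMeasure (modelLaw Q p.1 p.2) := inferInstance
  rw [modelLaw_eq_withDensity_ratio Q h₀ hp] at hfin ⊢
  exact renyiDiv_withDensity hα1 _ (measurable_ratio_left p) (ratio_pos h₀ hp)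
    (affinity_pos Q hα0 hα1 h₀ hp) (ofReal_affinity Q hα0 hα1 h₀ hp)

/-! ### The sample likelihood ratio and the fractional posterior. -/

/-- The likelihood ratio of the sample, to the power `α`. -/
noncomputable def sampleRatio {n : ℕ} (α : ℝ) (p₀ : EuclideanSpace ℝ (Fin d) × ℝ)
    (z : Fin n → ℝ × EuclideanSpace ℝ (Fin d)) (p : EuclideanSpace ℝ (Fin d) × ℝ) : ℝ :=
  ∏ i, ratio p₀ (z i) p ^ α

lemma measurable_sampleRatio {n : ℕ} :
    Measurable fun w : (Fin n → ℝ × EuclideanSpace ℝ (Fin d)) × (EuclideanSpace ℝ (Fin d) × ℝ) =>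
      sampleRatio α p₀ w.1 w.2 := by
  unfold sampleRatio
  refine Finset.measurable_prod _ fun i _ => Measurable.pow_const ?_ α
  exact measurable_ratio.comp
    (f := fun w : (Fin n → ℝ × EuclideanSpace ℝ (Fin d)) × (EuclideanSpace ℝ (Fin d) × ℝ) =>
      (w.1 i, w.2)) (by fun_prop)

lemma sampleRatio_nonneg {n : ℕ} (z : Fin n → ℝ × EuclideanSpace ℝ (Fin d))
    (p : EuclideanSpace ℝ (Fin d) × ℝ) : 0 ≤ sampleRatio α p₀ z p :=
  Finset.prod_nonneg fun _ _ => Real.rpow_nonneg (ratio_nonneg _ _) _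

lemma lintegral_sampleRatio {n : ℕ} (hα0 : 0 < α) (hα1 : α < 1) (h₀ : 0 < p₀.2)
    {p : EuclideanSpace ℝ (Fin d) × ℝ} (hp : 0 < p.2) :
    ∫⁻ z, ENNReal.ofReal (sampleRatio α p₀ z p) ∂(Measure.pi fun _ : Fin n => modelLaw Q p₀.1 p₀.2)
      = ENNReal.ofReal (affinity Q α p₀ p ^ n) := by
  have hm := (measurable_ratio_left (p₀ := p₀) p).pow_const α
  have hint : Integrable (fun z => ratio p₀ z p ^ α) (modelLaw Q p₀.1 p₀.2) := by
    refine ⟨hm.aestronglyMeasurable, ?_⟩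
    rw [hasFiniteIntegral_iff_ofReal
      (Filter.Eventually.of_forall fun z => Real.rpow_nonneg (ratio_nonneg _ _) _),
      ofReal_affinity Q hα0 hα1 h₀ hp]
    exact ENNReal.ofReal_lt_top
  unfold sampleRatio
  rw [← ofReal_integral_eq_lintegral_ofReal
    (Integrable.fintype_prod (𝕜 := ℝ) (f := fun _ : Fin n => fun z => ratio p₀ z p ^ α)
      fun _ => hint)
    (Filter.Eventually.of_forall fun z => Finset.prod_nonneg fun _ _ =>
      Real.rpow_nonneg (ratio_nonneg _ _) _),
    integral_fintype_prod_eq_pow fun z => ratio p₀ z p ^ α, Fintype.card_fin,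
    integral_eq_lintegral_of_nonneg_ae
      (Filter.Eventually.of_forall fun z => Real.rpow_nonneg (ratio_nonneg _ _) _)
      hm.aestronglyMeasurable, affinity]

lemma likelihood_rpow_eq {n : ℕ} (h₀ : 0 < p₀.2) (z : Fin n → ℝ × EuclideanSpace ℝ (Fin d))
    (p : EuclideanSpace ℝ (Fin d) × ℝ) :
    likelihood z p.1 p.2 ^ α = (∏ i, modelDensity (z i) p₀) ^ α * sampleRatio α p₀ z p := by
  have h1 : likelihood z p.1 p.2 = (∏ i, modelDensity (z i) p₀) * ∏ i, ratio p₀ (z i) p := by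
    rw [← Finset.prod_mul_distrib]
    refine Finset.prod_congr rfl fun i _ => ?_
    rw [ratio, mul_div_cancel₀ _ (modelDensity_pos h₀ _).ne']
    rfl
  rw [h1, Real.mul_rpow (Finset.prod_nonneg fun _ _ => modelDensity_nonneg _ _)
    (Finset.prod_nonneg fun _ _ => ratio_nonneg _ _), sampleRatio,
    Real.finsetProd_rpow _ _ fun _ _ => ratio_nonneg _ _]

lemma normalized_smul {S : Type*} [MeasurableSpace S] {c : ℝ≥0∞} (hc0 : c ≠ 0) (hc : c ≠ ∞)
    (μ : Measure S) : normalized (c • μ) = normalized μ := by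
  rw [normalized, normalized, Measure.smul_apply, smul_eq_mul, smul_smul,
    ENNReal.mul_inv (Or.inl hc0) (Or.inl hc), mul_right_comm, ENNReal.inv_mul_cancel hc0 hc, one_mul]

/-- The likelihood at `p₀` depends on the sample alone, so normalization removes it. -/
lemma fracPosterior_eq {n : ℕ} (h₀ : 0 < p₀.2) (π : Measure (EuclideanSpace ℝ (Fin d) × ℝ))
    (z : Fin n → ℝ × EuclideanSpace ℝ (Fin d)) :
    fracPosterior α π z
      = normalized (π.withDensity fun p => ENNReal.ofReal (sampleRatio α p₀ z p)) := by
  have hpos : 0 < (∏ i, modelDensity (z i) p₀) ^ α :=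
    Real.rpow_pos_of_pos (Finset.prod_pos fun _ _ => modelDensity_pos h₀ _) _
  unfold fracPosterior
  simp_rw [likelihood_rpow_eq h₀, ENNReal.ofReal_mul hpos.le]
  have hm : Measurable fun p => ENNReal.ofReal (sampleRatio α p₀ z p) :=
    (measurable_sampleRatio.comp (f := fun p => (z, p)) (by fun_prop)).ennreal_ofReal
  have := withDensity_smul (μ := π) (ENNReal.ofReal ((∏ i, modelDensity (z i) p₀) ^ α)) hm
  exact (congrArg normalized this).trans
    (normalized_smul (by simpa using hpos) ENNReal.ofReal_ne_top _)

end Model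

/-! ### Gibbs posteriors and the tangent line of the exponential -/

/-- With `Z = ∫ f`, integrate `X + log Z + 1 ≤ Z e^X` against `f / Z`. This replaces the logarithm
of the Gibbs variational bound by something linear in `W`, whose expectation is easy to control. -/
lemma lintegral_normalized_withDensity_le {S : Type*} [MeasurableSpace S] {π : Measure S}
    {f X : S → ℝ} (hf : Measurable f) (hX : Measurable X) (hf0 : ∀ p, 0 ≤ f p)
    (hX0 : ∀ᵐ p ∂π, 0 ≤ X p)
    (hW : ∫⁻ p, ENNReal.ofReal (f p * Real.exp (X p)) ∂π ≠ ∞)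
    {k : ℝ} (hk : Integrable f π → Real.exp (-k) ≤ ∫ p, f p ∂π) :
    ∫⁻ p, ENNReal.ofReal (X p) ∂normalized (π.withDensity fun p => ENNReal.ofReal (f p))
        ≤ ENNReal.ofReal ((∫⁻ p, ENNReal.ofReal (f p * Real.exp (X p)) ∂π).toReal + k - 1) ∧
      0 ≤ (∫⁻ p, ENNReal.ofReal (f p * Real.exp (X p)) ∂π).toReal + k - 1 := by
  have hfe0 : ∀ p, 0 ≤ f p * Real.exp (X p) := fun p => mul_nonneg (hf0 p) (Real.exp_pos _).le
  have hfe : Integrable (fun p => f p * Real.exp (X p)) π := by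
    refine ⟨by fun_prop, ?_⟩
    rw [hasFiniteIntegral_iff_ofReal (Filter.Eventually.of_forall hfe0)]
    exact hW.lt_top
  have hfi : Integrable f π := by
    refine hfe.mono' (by fun_prop) ?_
    filter_upwards [hX0] with p hp
    rw [Real.norm_of_nonneg (hf0 p)]
    exact le_mul_of_one_le_right (hf0 p) (Real.one_le_exp hp)
  have hfX : Integrable (fun p => f p * X p) π := by
    refine hfe.mono' (by fun_prop) ?_
    filter_upwards [hX0] with p hp
    rw [Real.norm_of_nonneg (mul_nonneg (hf0 p) hp)]
    gcongr
    · exact hf0 p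
    · linarith [Real.add_one_le_exp (X p)]
  have hk' := hk hfi
  set Z := ∫ p, f p ∂π with hZ
  have hZ0 : 0 < Z := (Real.exp_pos _).trans_le hk'
  rw [← integral_eq_lintegral_of_nonneg_ae (Filter.Eventually.of_forall hfe0) (by fun_prop)]
  set W := ∫ p, f p * Real.exp (X p) ∂π with hWdef
  have hZW : Z ≤ W := by
    refine integral_mono_ae hfi hfe ?_
    filter_upwards [hX0] with p hp
    exact le_mul_of_one_le_right (hf0 p) (Real.one_le_exp hp)
  -- Nonnegativity follows from `W ≥ Z ≥ e^(-k) ≥ 1 - k`.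
  refine ⟨?_, by linarith [Real.add_one_le_exp (-k)]⟩
  have hmass : (π.withDensity fun p => ENNReal.ofReal (f p)) Set.univ = ENNReal.ofReal Z := by
    rw [withDensity_apply _ MeasurableSet.univ, Measure.restrict_univ, hZ,
      ofReal_integral_eq_lintegral_ofReal hfi (Filter.Eventually.of_forall hf0)]
  have hnum : ∫⁻ p, ENNReal.ofReal (X p) ∂(π.withDensity fun p => ENNReal.ofReal (f p))
      = ENNReal.ofReal (∫ p, f p * X p ∂π) := by
    rw [lintegral_withDensity_eq_lintegral_mul _ (by fun_prop) (by fun_prop),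
      ofReal_integral_eq_lintegral_ofReal hfX]
    · exact lintegral_congr fun p => (ENNReal.ofReal_mul (hf0 p)).symm
    · filter_upwards [hX0] with p hp using mul_nonneg (hf0 p) hp
  rw [normalized, lintegral_smul_measure, hmass, hnum, smul_eq_mul, ← ENNReal.ofReal_inv_of_pos hZ0,
    ← ENNReal.ofReal_mul (by positivity)]
  refine ENNReal.ofReal_le_ofReal ?_
  have hint : ∫ p, f p * X p ∂π ≤ ∫ p, (Z * (f p * Real.exp (X p)) - (Real.log Z + 1) * f p) ∂π := by
    refine integral_mono hfX ((hfe.const_mul _).sub (hfi.const_mul _)) fun p => ?_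
    have h := Real.add_one_le_exp (X p + Real.log Z)
    rw [Real.exp_add, Real.exp_log hZ0] at h
    simp only
    nlinarith [mul_le_mul_of_nonneg_left h (hf0 p)]
  rw [integral_sub (hfe.const_mul _) (hfi.const_mul _), integral_const_mul, integral_const_mul,
    ← hZ, ← hWdef] at hint
  have hlog : -k ≤ Real.log Z := (Real.le_log_iff_exp_le hZ0).2 hk'
  rw [inv_mul_le_iff₀ hZ0]
  nlinarith

/-- Jensen on `B`, proved with the tangent of `exp` at the average of `w`. -/
lemma exp_average_mul_le_integral {S E : Type*} [MeasurableSpace S] [NormedAddCommGroup E]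
    [InnerProductSpace ℝ E] [CompleteSpace E] {π : Measure S} [IsFiniteMeasure π] {f : S → ℝ}
    (hf : Integrable f π) (hf0 : ∀ p, 0 ≤ f p) {B : Set S} (hB : MeasurableSet B)
    (hB0 : 0 < π.real B) {w : S → E} (hw : IntegrableOn w B π) {u : ℝ} {v : E}
    (hle : ∀ p ∈ B, Real.exp (u + inner ℝ v (w p)) ≤ f p) :
    Real.exp (u + inner ℝ v ((π.real B)⁻¹ • ∫ p in B, w p ∂π)) * π.real B ≤ ∫ p, f p ∂π := by
  set m := (π.real B)⁻¹ • ∫ p in B, w p ∂π with hm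
  set c := Real.exp (u + inner ℝ v m) with hc
  have hwv : IntegrableOn (fun p => inner ℝ v (w p)) B π := hw.const_inner v
  have hle' : ∀ p ∈ B, c * (1 - inner ℝ v m) + c * inner ℝ v (w p) ≤ f p := by
    intro p hp
    refine le_trans ?_ (hle p hp)
    have h := Real.add_one_le_exp (inner ℝ v (w p) - inner ℝ v m)
    have e : Real.exp (u + inner ℝ v (w p))
        = c * Real.exp (inner ℝ v (w p) - inner ℝ v m) := by
      rw [hc, ← Real.exp_add]; congr 1; ring
    rw [e]
    nlinarith [mul_le_mul_of_nonneg_left h (Real.exp_pos (u + inner ℝ v m)).le]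
  calc c * π.real B
      = ∫ p in B, (c * (1 - inner ℝ v m) + c * inner ℝ v (w p)) ∂π := by
        rw [integral_add (integrable_const _) (hwv.const_mul _), setIntegral_const,
          integral_const_mul, integral_inner hw, smul_eq_mul]
        have : inner ℝ v (∫ p in B, w p ∂π) = π.real B * inner ℝ v m := by
          rw [hm, inner_smul_right]; field_simp
        rw [this]; ring
    _ ≤ ∫ p in B, f p ∂π :=
        setIntegral_mono_on ((integrable_const _).add (hwv.const_mul _)) hf.integrableOn hB hle'
    _ ≤ ∫ p, f p ∂π := setIntegral_le_integral hf (Filter.Eventually.of_forall hf0)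

section Model

variable {d : ℕ}

/-! ### The likelihood ratio near the true parameter -/

/-- The parameter enters the exponent only through the linear term, as Jensen requires. Taking `σ ≥
σ₀` lets the terms in the squared noise be dropped. -/
lemma exp_le_ratio {p₀ p : EuclideanSpace ℝ (Fin d) × ℝ} {δ r : ℝ} (h₀ : 0 < p₀.2)
    (hr : ‖p.1 - p₀.1‖ ^ 2 ≤ r) (hσ : p₀.2 ≤ p.2) (hσ' : p.2 ≤ p₀.2 * √(1 + δ))
    (z : ℝ × EuclideanSpace ℝ (Fin d)) :
    Real.exp (-(δ / 2 + ‖z.2‖ ^ 2 * r / (2 * p₀.2 ^ 2))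
      + (z.1 - inner ℝ z.2 p₀.1) * inner ℝ z.2 ((p.2 ^ 2)⁻¹ • (p.1 - p₀.1))) ≤ ratio p₀ z p := by
  obtain ⟨θ₀, σ₀⟩ := p₀
  obtain ⟨θ, σ⟩ := p
  obtain ⟨y, x⟩ := z
  simp only at *
  have hσ0 : 0 < σ := h₀.trans_le hσ
  set ε := y - inner ℝ x θ₀ with hε
  set g := inner ℝ x (θ - θ₀) with hg
  have hyθ : y - inner ℝ x θ = ε - g := by rw [hε, hg, inner_sub_right]; ring
  have hrat : ratio (θ₀, σ₀) (y, x) (θ, σ)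
      = (σ₀ / σ) * Real.exp (ε ^ 2 / (2 * σ₀ ^ 2) - (ε - g) ^ 2 / (2 * σ ^ 2)) := by
    simp only [ratio, modelDensity, gaussianPDFReal, Real.coe_toNNReal _ (sq_nonneg _)]
    rw [hyθ, ← hε, Real.sqrt_mul (by positivity) (σ ^ 2), Real.sqrt_mul (by positivity) (σ₀ ^ 2),
      Real.sqrt_sq hσ0.le, Real.sqrt_sq h₀.le, Real.exp_sub, neg_div, neg_div, Real.exp_neg,
      Real.exp_neg]
    have : 0 < √(2 * Real.pi) := by positivity
    field_simp
  rw [hrat]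
  -- From `1 + δ ≤ e^δ`, that is, `√(1 + δ) ≤ e^(δ/2)`.
  have h1 : Real.exp (-(δ / 2)) ≤ σ₀ / σ := by
    rw [Real.exp_neg, le_div_iff₀ hσ0, inv_mul_le_iff₀ (Real.exp_pos _), mul_comm]
    refine hσ'.trans (mul_le_mul_of_nonneg_left ?_ h₀.le)
    rw [Real.sqrt_le_iff]
    refine ⟨(Real.exp_pos _).le, ?_⟩
    rw [← Real.exp_nat_mul]
    have : ((2 : ℕ) : ℝ) * (δ / 2) = δ := by push_cast; ring
    rw [this]
    linarith [Real.add_one_le_exp δ]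
  have hs : σ₀ ^ 2 ≤ σ ^ 2 := by gcongr
  have hg2 : g ^ 2 ≤ ‖x‖ ^ 2 * r := by
    have := abs_real_inner_le_norm x (θ - θ₀)
    calc g ^ 2 = |g| ^ 2 := (sq_abs g).symm
      _ ≤ (‖x‖ * ‖θ - θ₀‖) ^ 2 := by gcongr
      _ = ‖x‖ ^ 2 * ‖θ - θ₀‖ ^ 2 := by ring
      _ ≤ _ := by gcongr
  have hr0 : 0 ≤ ‖x‖ ^ 2 * r := (sq_nonneg g).trans hg2
  have h2 : -(‖x‖ ^ 2 * r / (2 * σ₀ ^ 2)) + ε * inner ℝ x ((σ ^ 2)⁻¹ • (θ - θ₀))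
      ≤ ε ^ 2 / (2 * σ₀ ^ 2) - (ε - g) ^ 2 / (2 * σ ^ 2) := by
    rw [inner_smul_right, ← hg]
    have e1 : ε ^ 2 / (2 * σ ^ 2) ≤ ε ^ 2 / (2 * σ₀ ^ 2) := by gcongr
    have e2 : g ^ 2 / (2 * σ ^ 2) ≤ ‖x‖ ^ 2 * r / (2 * σ₀ ^ 2) := by gcongr
    have e3 : (ε - g) ^ 2 / (2 * σ ^ 2)
        = ε ^ 2 / (2 * σ ^ 2) - ε * ((σ ^ 2)⁻¹ * g) + g ^ 2 / (2 * σ ^ 2) := by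
      field_simp; ring
    linarith
  calc _ = Real.exp (-(δ / 2)) * Real.exp (-(‖x‖ ^ 2 * r / (2 * σ₀ ^ 2))
        + ε * inner ℝ x ((σ ^ 2)⁻¹ • (θ - θ₀))) := by rw [← Real.exp_add]; congr 1; ring
    _ ≤ _ := by gcongr

lemma exp_le_sampleRatio {n : ℕ} {α : ℝ} (hα : 0 < α) {p₀ p : EuclideanSpace ℝ (Fin d) × ℝ}
    {δ r : ℝ} (h₀ : 0 < p₀.2)
    (hr : ‖p.1 - p₀.1‖ ^ 2 ≤ r) (hσ : p₀.2 ≤ p.2) (hσ' : p.2 ≤ p₀.2 * √(1 + δ))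
    (z : Fin n → ℝ × EuclideanSpace ℝ (Fin d)) :
    Real.exp (-(α * ∑ i, (δ / 2 + ‖(z i).2‖ ^ 2 * r / (2 * p₀.2 ^ 2)))
      + inner ℝ (α • ∑ i, ((z i).1 - inner ℝ (z i).2 p₀.1) • (z i).2)
          ((p.2 ^ 2)⁻¹ • (p.1 - p₀.1))) ≤ sampleRatio α p₀ z p := by
  have h := fun i => Real.rpow_le_rpow (Real.exp_pos _).le
    (exp_le_ratio h₀ hr hσ hσ' (z i)) hα.le
  refine le_trans (le_of_eq ?_) (Finset.prod_le_prod (s := Finset.univ)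
    (fun i _ => Real.rpow_nonneg (Real.exp_pos _).le _) fun i _ => h i)
  simp_rw [← Real.exp_mul]
  rw [← Real.exp_sum]
  congr 1
  rw [← Finset.sum_mul, Finset.sum_add_distrib (f := fun i => -_), Finset.sum_neg_distrib,
    real_inner_smul_left, sum_inner]
  simp_rw [real_inner_smul_left]
  ring

variable (Q : Measure (EuclideanSpace ℝ (Fin d)))

/-! ### Moments of the observations -/

lemma integrable_norm_sq {Cx : ℝ} (hQ : ∫⁻ x, ‖x‖ₑ ^ 2 ∂Q < ENNReal.ofReal (Cx ^ 2)) :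
    Integrable (fun x => ‖x‖ ^ 2) Q := by
  refine ⟨by fun_prop, ?_⟩
  rw [hasFiniteIntegral_iff_enorm]
  simpa using hQ.trans ENNReal.ofReal_lt_top

lemma integral_norm_sq_le {Cx : ℝ} (hQ : ∫⁻ x, ‖x‖ₑ ^ 2 ∂Q < ENNReal.ofReal (Cx ^ 2)) :
    ∫ x, ‖x‖ ^ 2 ∂Q ≤ Cx ^ 2 := by
  rw [integral_eq_lintegral_of_nonneg_ae (Filter.Eventually.of_forall fun _ => by positivity)
    (by fun_prop)]
  refine ENNReal.toReal_le_of_le_ofReal (by positivity) (le_trans (le_of_eq ?_) hQ.le)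
  exact lintegral_congr fun x => by rw [ENNReal.ofReal_pow (norm_nonneg _), ofReal_norm]

lemma integrable_noise_mul (θ : EuclideanSpace ℝ (Fin d)) (σ : ℝ)
    {g : EuclideanSpace ℝ (Fin d) → ℝ} (hgm : Measurable g) (hg : Integrable g Q) :
    Integrable (fun z => (z.1 - inner ℝ z.2 θ) * g z.2) (modelLaw Q θ σ) := by
  rw [modelLaw, integrable_map_measure (Measurable.aestronglyMeasurable (by fun_prop))
    (by fun_prop)]
  have h : Integrable (fun e : ℝ => e) (gaussianReal 0 (σ ^ 2).toNNReal) :=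
    (memLp_id_gaussianReal 1).integrable (by simp)
  refine (hg.mul_prod h).congr (Filter.Eventually.of_forall fun p => ?_)
  simp [mul_comm]

lemma integrable_modelLaw_snd (θ : EuclideanSpace ℝ (Fin d)) (σ : ℝ)
    {g : EuclideanSpace ℝ (Fin d) → ℝ} (hgm : Measurable g) (hg : Integrable g Q) :
    Integrable (fun z => g z.2) (modelLaw Q θ σ) := by
  rw [modelLaw, integrable_map_measure (Measurable.aestronglyMeasurable (by fun_prop))
    (by fun_prop)]
  exact hg.comp_fst _

variable [IsProbabilityMeasure Q]

lemma integral_modelLaw_snd (θ : EuclideanSpace ℝ (Fin d)) (σ : ℝ)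
    {g : EuclideanSpace ℝ (Fin d) → ℝ} (hgm : Measurable g) :
    ∫ z, g z.2 ∂modelLaw Q θ σ = ∫ x, g x ∂Q := by
  rw [modelLaw, integral_map (by fun_prop) (Measurable.aestronglyMeasurable (by fun_prop))]
  simp [integral_fun_fst]

/-- The noise is centred and independent of the design. -/
lemma integral_noise_mul (θ : EuclideanSpace ℝ (Fin d)) (σ : ℝ)
    {g : EuclideanSpace ℝ (Fin d) → ℝ} (hgm : Measurable g) :
    ∫ z, (z.1 - inner ℝ z.2 θ) * g z.2 ∂modelLaw Q θ σ = 0 := by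
  rw [modelLaw, integral_map (by fun_prop) (Measurable.aestronglyMeasurable (by fun_prop))]
  have := integral_prod_mul (L := ℝ) (μ := Q) (ν := gaussianReal 0 (σ ^ 2).toNNReal) g (fun e : ℝ => e)
  rw [integral_id_gaussianReal, mul_zero] at this
  refine Eq.trans ?_ this
  congr 1
  ext p
  simp [mul_comm]

end Model

section Model

variable {d : ℕ}

/-! ### The oracle bound for a general prior -/

lemma measurableSet_nhd (p₀ : EuclideanSpace ℝ (Fin d) × ℝ) (r δ : ℝ) :
    MeasurableSet {p : EuclideanSpace ℝ (Fin d) × ℝ |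
      ‖p.1 - p₀.1‖ ^ 2 ≤ r ∧ p.2 ∈ Set.Icc p₀.2 (p₀.2 * √(1 + δ))} :=
  MeasurableSet.inter (s₁ := {p : EuclideanSpace ℝ (Fin d) × ℝ | ‖p.1 - p₀.1‖ ^ 2 ≤ r})
    (measurableSet_le (by fun_prop) (by fun_prop)) (measurableSet_Icc.preimage measurable_snd)

lemma integrableOn_nhd (π : Measure (EuclideanSpace ℝ (Fin d) × ℝ)) [IsFiniteMeasure π]
    {p₀ : EuclideanSpace ℝ (Fin d) × ℝ} (h₀ : 0 < p₀.2) (r δ : ℝ) :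
    IntegrableOn (fun p : EuclideanSpace ℝ (Fin d) × ℝ => (p.2 ^ 2)⁻¹ • (p.1 - p₀.1))
      {p | ‖p.1 - p₀.1‖ ^ 2 ≤ r ∧ p.2 ∈ Set.Icc p₀.2 (p₀.2 * √(1 + δ))} π := by
  refine Integrable.mono' (g := fun _ => (p₀.2 ^ 2)⁻¹ * √r) (integrable_const _)
    (by fun_prop) ?_
  filter_upwards [ae_restrict_mem (measurableSet_nhd p₀ r δ)] with p hp
  have h1 : p₀.2 ≤ p.2 := hp.2.1
  rw [norm_smul, Real.norm_of_nonneg (by positivity)]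
  gcongr
  exact Real.le_sqrt_of_sq_le hp.1

variable (Q : Measure (EuclideanSpace ℝ (Fin d))) [IsProbabilityMeasure Q]

/-- After Fubini the inner integral is `A ^ n · A ^ (-n) = 1` for almost every parameter. -/
lemma lintegral_lintegral_sampleRatio_le {n : ℕ} {α : ℝ} (hα0 : 0 < α) (hα1 : α < 1)
    {p₀ : EuclideanSpace ℝ (Fin d) × ℝ} (h₀ : 0 < p₀.2)
    (π : Measure (EuclideanSpace ℝ (Fin d) × ℝ)) [IsFiniteMeasure π] (hπ : π Set.univ ≤ 1)
    (hpos : ∀ᵐ p ∂π, 0 < p.2) :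
    ∫⁻ z, ∫⁻ p, ENNReal.ofReal (sampleRatio α p₀ z p
        * Real.exp (-(n * Real.log (affinity Q α p₀ p)))) ∂π
      ∂(Measure.pi fun _ : Fin n => modelLaw Q p₀.1 p₀.2) ≤ 1 := by
  have hA := measurable_affinity Q (p₀ := p₀) α
  have hmeas : Measurable fun w : (Fin n → ℝ × EuclideanSpace ℝ (Fin d)) ×
      (EuclideanSpace ℝ (Fin d) × ℝ) => ENNReal.ofReal (sampleRatio α p₀ w.1 w.2
        * Real.exp (-(n * Real.log (affinity Q α p₀ w.2)))) :=
    (measurable_sampleRatio.mul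
      ((Real.measurable_log.comp (hA.comp measurable_snd)).const_mul _).neg.exp).ennreal_ofReal
  rw [lintegral_lintegral_swap hmeas.aemeasurable]
  refine le_trans (lintegral_mono_ae (g := fun _ => 1) ?_) (by simpa using hπ)
  filter_upwards [hpos] with p hp
  have hA0 := affinity_pos Q hα0 hα1 h₀ hp
  simp_rw [ENNReal.ofReal_mul (sampleRatio_nonneg _ p)]
  have hm : Measurable fun z : Fin n → ℝ × EuclideanSpace ℝ (Fin d) => sampleRatio α p₀ z p :=
    measurable_sampleRatio.comp (f := fun z => (z, p)) (by fun_prop)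
  rw [lintegral_mul_const _ hm.ennreal_ofReal, lintegral_sampleRatio Q hα0 hα1 h₀ hp,
    ← ENNReal.ofReal_mul (by positivity), Real.exp_neg, Real.exp_nat_mul, Real.exp_log hA0,
    mul_inv_cancel₀ (by positivity), ENNReal.ofReal_one]

theorem lintegral_renyiDiv_fracPosterior_le {n : ℕ} (hn : 0 < n) {α : ℝ} (hα0 : 0 < α)
    (hα1 : α < 1) {p₀ : EuclideanSpace ℝ (Fin d) × ℝ} (h₀ : 0 < p₀.2) {Cx : ℝ}
    (hQ : ∫⁻ x, ‖x‖ₑ ^ 2 ∂Q < ENNReal.ofReal (Cx ^ 2))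
    (π : Measure (EuclideanSpace ℝ (Fin d) × ℝ)) [IsFiniteMeasure π] (hπ : π Set.univ ≤ 1)
    (hpos : ∀ᵐ p ∂π, 0 < p.2) {r δ : ℝ} (hr : 0 ≤ r)
    (hB0 : 0 < π.real {p : EuclideanSpace ℝ (Fin d) × ℝ |
      ‖p.1 - p₀.1‖ ^ 2 ≤ r ∧ p.2 ∈ Set.Icc p₀.2 (p₀.2 * √(1 + δ))}) :
    ∫⁻ z, ∫⁻ p, renyiDiv α (modelLaw Q p.1 p.2) (modelLaw Q p₀.1 p₀.2) ∂(fracPosterior α π z)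
        ∂(Measure.pi fun _ : Fin n => modelLaw Q p₀.1 p₀.2)
      ≤ ENNReal.ofReal ((n * (1 - α))⁻¹ *
        (-Real.log (π.real {p : EuclideanSpace ℝ (Fin d) × ℝ |
          ‖p.1 - p₀.1‖ ^ 2 ≤ r ∧ p.2 ∈ Set.Icc p₀.2 (p₀.2 * √(1 + δ))})
          + α * (n * (δ / 2 + Cx ^ 2 * r / (2 * p₀.2 ^ 2))))) := by
  set B := {p : EuclideanSpace ℝ (Fin d) × ℝ |
      ‖p.1 - p₀.1‖ ^ 2 ≤ r ∧ p.2 ∈ Set.Icc p₀.2 (p₀.2 * √(1 + δ))} with hB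
  set P := Measure.pi fun _ : Fin n => modelLaw Q p₀.1 p₀.2 with hP
  have hn' : (0 : ℝ) < n := by exact_mod_cast hn
  have hα1' : 0 < 1 - α := by linarith
  set X : EuclideanSpace ℝ (Fin d) × ℝ → ℝ := fun p => -(n * Real.log (affinity Q α p₀ p)) with hX
  have hXm : Measurable X :=
    ((Real.measurable_log.comp (measurable_affinity Q α)).const_mul _).neg
  have hX0 : ∀ᵐ p ∂π, 0 ≤ X p := by
    filter_upwards [hpos] with p hp
    have := Real.log_nonpos (affinity_pos Q hα0 hα1 h₀ hp).le (affinity_le_one Q hα0 hα1 h₀ hp)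
    exact neg_nonneg.2 (mul_nonpos_of_nonneg_of_nonpos hn'.le this)
  set W : (Fin n → ℝ × EuclideanSpace ℝ (Fin d)) → ℝ≥0∞ := fun z =>
    ∫⁻ p, ENNReal.ofReal (sampleRatio α p₀ z p * Real.exp (X p)) ∂π with hW
  have hWm : Measurable W := by
    refine Measurable.lintegral_prod_right' (f := fun w =>
      ENNReal.ofReal (sampleRatio α p₀ w.1 w.2 * Real.exp (X w.2))) ?_
    exact (measurable_sampleRatio.mul (hXm.comp measurable_snd).exp).ennreal_ofReal
  have hW1 : ∫⁻ z, W z ∂P ≤ 1 :=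
    lintegral_lintegral_sampleRatio_le Q hα0 hα1 h₀ π hπ hpos
  have hWtop : ∀ᵐ z ∂P, W z < ∞ :=
    ae_lt_top hWm (ne_top_of_le_ne_top ENNReal.one_ne_top hW1)
  -- `m` does not depend on the sample, so the noise sum in `k` below has mean zero.
  set m := (π.real B)⁻¹ • ∫ p in B, (p.2 ^ 2)⁻¹ • (p.1 - p₀.1) ∂π with hm
  set k : (Fin n → ℝ × EuclideanSpace ℝ (Fin d)) → ℝ := fun z =>
    -Real.log (π.real B) + α * ∑ i, (δ / 2 + ‖(z i).2‖ ^ 2 * r / (2 * p₀.2 ^ 2))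
      - α * ∑ i, ((z i).1 - inner ℝ (z i).2 p₀.1) * inner ℝ (z i).2 m with hk
  have hkey : ∀ᵐ z ∂P, ∫⁻ p, renyiDiv α (modelLaw Q p.1 p.2) (modelLaw Q p₀.1 p₀.2)
      ∂(fracPosterior α π z)
        ≤ ENNReal.ofReal ((n * (1 - α))⁻¹) * ENNReal.ofReal ((W z).toReal + k z - 1) ∧
      0 ≤ (W z).toReal + k z - 1 := by
    filter_upwards [hWtop] with z hz
    have hmz : Measurable fun p => sampleRatio α p₀ z p :=
      measurable_sampleRatio.comp (f := fun p => (z, p)) (by fun_prop)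
    have hle := lintegral_normalized_withDensity_le hmz hXm (sampleRatio_nonneg z) hX0 hz.ne
      (k := k z) fun hint => by
        have h := exp_average_mul_le_integral hint (sampleRatio_nonneg z)
          (measurableSet_nhd p₀ r δ) hB0 (integrableOn_nhd π h₀ r δ)
          (fun p hp => exp_le_sampleRatio hα0 h₀ hp.1 hp.2.1 hp.2.2 z)
        refine le_trans (le_of_eq ?_) h
        rw [← hB, ← hm]
        conv_rhs => rw [← Real.exp_log hB0]
        rw [← Real.exp_add]
        congr 1
        rw [hk, real_inner_smul_left, sum_inner]
        simp_rw [real_inner_smul_left]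
        ring
    refine ⟨?_, hle.2⟩
    rw [fracPosterior_eq h₀]
    have hae : ∀ᵐ p ∂normalized (π.withDensity fun p => ENNReal.ofReal (sampleRatio α p₀ z p)),
        0 < p.2 :=
      Measure.ae_smul_measure ((withDensity_absolutelyContinuous _ _).ae_le hpos) _
    have hcongr : ∀ᵐ p ∂normalized (π.withDensity fun p => ENNReal.ofReal (sampleRatio α p₀ z p)),
        renyiDiv α (modelLaw Q p.1 p.2) (modelLaw Q p₀.1 p₀.2)
          = ENNReal.ofReal ((n * (1 - α))⁻¹) * ENNReal.ofReal (X p) := by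
      filter_upwards [hae] with p hp
      rw [renyiDiv_modelLaw Q hα0 hα1 h₀ hp, ← ENNReal.ofReal_mul (by positivity)]
      congr 1
      rw [hX]
      field_simp
    rw [lintegral_congr_ae hcongr, lintegral_const_mul _ hXm.ennreal_ofReal]
    gcongr
    exact hle.1
  have hWi : Integrable (fun z => (W z).toReal) P :=
    integrable_toReal_of_lintegral_ne_top hWm.aemeasurable
      (ne_top_of_le_ne_top ENNReal.one_ne_top hW1)
  have hsq := integrable_norm_sq Q hQ
  have hi1 : Integrable (fun z : ℝ × EuclideanSpace ℝ (Fin d) =>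
      δ / 2 + ‖z.2‖ ^ 2 * r / (2 * p₀.2 ^ 2)) (modelLaw Q p₀.1 p₀.2) :=
    integrable_modelLaw_snd Q p₀.1 p₀.2 (g := fun x => δ / 2 + ‖x‖ ^ 2 * r / (2 * p₀.2 ^ 2))
      (by fun_prop) ((integrable_const _).add ((hsq.mul_const r).div_const _))
  -- A finite second moment gives a finite first moment, since `Q` is a probability.
  have hxm : Integrable (fun x => inner ℝ x m) Q := by
    have hx : Integrable (fun x => x) Q :=
      ((memLp_two_iff_integrable_sq_norm (by fun_prop)).2 hsq).integrable (by norm_num)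
    exact hx.inner_const m
  have hi2 : Integrable (fun z : ℝ × EuclideanSpace ℝ (Fin d) =>
      (z.1 - inner ℝ z.2 p₀.1) * inner ℝ z.2 m) (modelLaw Q p₀.1 p₀.2) :=
    integrable_noise_mul Q p₀.1 p₀.2 (by fun_prop) hxm
  have hi1' : ∀ i, Integrable (fun z : Fin n → ℝ × EuclideanSpace ℝ (Fin d) =>
      δ / 2 + ‖(z i).2‖ ^ 2 * r / (2 * p₀.2 ^ 2)) P := fun i =>
    integrable_comp_eval (μ := fun _ : Fin n => modelLaw Q p₀.1 p₀.2) hi1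
  have hi2' : ∀ i, Integrable (fun z : Fin n → ℝ × EuclideanSpace ℝ (Fin d) =>
      ((z i).1 - inner ℝ (z i).2 p₀.1) * inner ℝ (z i).2 m) P := fun i =>
    integrable_comp_eval (μ := fun _ : Fin n => modelLaw Q p₀.1 p₀.2) hi2
  have hI1 : Integrable (fun z : Fin n → ℝ × EuclideanSpace ℝ (Fin d) =>
      ∑ i, (δ / 2 + ‖(z i).2‖ ^ 2 * r / (2 * p₀.2 ^ 2))) P :=
    integrable_finsetSum _ fun i _ => hi1' i
  have hI2 : Integrable (fun z : Fin n → ℝ × EuclideanSpace ℝ (Fin d) =>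
      ∑ i, ((z i).1 - inner ℝ (z i).2 p₀.1) * inner ℝ (z i).2 m) P :=
    integrable_finsetSum _ fun i _ => hi2' i
  have hI1' : Integrable (fun z : Fin n → ℝ × EuclideanSpace ℝ (Fin d) =>
      -Real.log (π.real B) + α * ∑ i, (δ / 2 + ‖(z i).2‖ ^ 2 * r / (2 * p₀.2 ^ 2))) P :=
    (integrable_const _).add (hI1.const_mul α)
  have hki : Integrable k P := hI1'.sub (hI2.const_mul α)
  have hWk : Integrable (fun z => (W z).toReal + k z) P := hWi.add hki
  have hWk1 : Integrable (fun z => (W z).toReal + k z - 1) P := hWk.sub (integrable_const 1)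
  have hkint : ∫ z, k z ∂P ≤ -Real.log (π.real B)
      + α * (n * (δ / 2 + Cx ^ 2 * r / (2 * p₀.2 ^ 2))) := by
    have e1 : ∫ z, ∑ i, (δ / 2 + ‖(z i).2‖ ^ 2 * r / (2 * p₀.2 ^ 2)) ∂P
        = n * (δ / 2 + (∫ x, ‖x‖ ^ 2 ∂Q) * r / (2 * p₀.2 ^ 2)) := by
      rw [integral_finsetSum _ fun i _ => hi1' i]
      simp_rw [hP]
      rw [Finset.sum_congr rfl fun i _ => integral_comp_eval
        (μ := fun _ : Fin n => modelLaw Q p₀.1 p₀.2) (i := i) hi1.aestronglyMeasurable]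
      rw [integral_modelLaw_snd Q p₀.1 p₀.2 (g := fun x => δ / 2 + ‖x‖ ^ 2 * r / (2 * p₀.2 ^ 2))
        (by fun_prop), integral_add (integrable_const _) ((hsq.mul_const r).div_const _),
        integral_const, integral_div, integral_mul_const, probReal_univ, one_smul, Finset.sum_const,
        Finset.card_univ, Fintype.card_fin, nsmul_eq_mul]
    have e2 : ∫ z, ∑ i, ((z i).1 - inner ℝ (z i).2 p₀.1) * inner ℝ (z i).2 m ∂P = 0 := by
      rw [integral_finsetSum _ fun i _ => hi2' i]
      refine Finset.sum_eq_zero fun i _ => ?_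
      rw [hP, integral_comp_eval (μ := fun _ : Fin n => modelLaw Q p₀.1 p₀.2) (i := i)
        hi2.aestronglyMeasurable]
      exact integral_noise_mul Q p₀.1 p₀.2 (g := fun x => inner ℝ x m) (by fun_prop)
    have e3 : ∫ z, k z ∂P = -Real.log (π.real B)
        + α * (n * (δ / 2 + (∫ x, ‖x‖ ^ 2 ∂Q) * r / (2 * p₀.2 ^ 2))) := by
      simp only [hk]
      rw [integral_sub hI1' (hI2.const_mul α),
        integral_add (integrable_const _) (hI1.const_mul α), integral_const_mul,
        integral_const_mul, e1, e2]
      simp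
    rw [e3]
    have := integral_norm_sq_le Q hQ
    gcongr
  have hWint : ∫ z, (W z).toReal ∂P ≤ 1 := by
    rw [integral_toReal hWm.aemeasurable hWtop]
    exact ENNReal.toReal_le_of_le_ofReal zero_le_one (by simpa using hW1)
  have htot : ∫ z, ((W z).toReal + k z - 1) ∂P ≤ -Real.log (π.real B)
      + α * (n * (δ / 2 + Cx ^ 2 * r / (2 * p₀.2 ^ 2))) := by
    rw [integral_sub hWk (integrable_const _), integral_add hWi hki]
    simp only [integral_const, probReal_univ, smul_eq_mul, mul_one]
    linarith
  calc _ ≤ ∫⁻ z, ENNReal.ofReal ((n * (1 - α))⁻¹) * ENNReal.ofReal ((W z).toReal + k z - 1) ∂P :=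
        lintegral_mono_ae (hkey.mono fun z hz => hz.1)
    _ = ENNReal.ofReal ((n * (1 - α))⁻¹ * ∫ z, ((W z).toReal + k z - 1) ∂P) := by
        rw [lintegral_const_mul' _ _ ENNReal.ofReal_ne_top, ENNReal.ofReal_mul (by positivity),
          ofReal_integral_eq_lintegral_ofReal hWk1
            (hkey.mono fun z hz => hz.2)]
    _ ≤ _ := ENNReal.ofReal_le_ofReal (by gcongr)

end Model

/-! ### Prior mass in terms of the rate -/

section Mass

variable {d : ℕ}

lemma l0norm_eq_card (θ : EuclideanSpace ℝ (Fin d)) :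
    l0norm θ = (Finset.univ.filter fun i => θ i ≠ 0).card := by
  rw [l0norm, ← Set.ncard_coe_finset]
  simp

lemma log_two_le_rate {s d : ℕ} {T : ℝ} (hs : 1 ≤ s) (hsd : s ≤ d) (hT : 2 * d ≤ T) :
    s * Real.log 2 ≤ s * Real.log (T / s) := by
  have hs' : (1 : ℝ) ≤ s := by exact_mod_cast hs
  have hsd' : (s : ℝ) ≤ d := by exact_mod_cast hsd
  gcongr
  rw [le_div_iff₀ (by positivity)]
  linarith

/-- Split `log n ≤ log T = log s + log (T / s)`. Each summand is at most the rate: the first through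
`log s ≤ s log 2`, the second because `s ≥ 1`. -/
lemma log_le_rate {s d n : ℕ} {T : ℝ} (hs : 1 ≤ s) (hsd : s ≤ d) (hn : 1 ≤ n) (hnd : n ≤ d)
    (hT : 2 * d ≤ T) : Real.log n ≤ 2 * (s * Real.log (T / s)) := by
  have hs' : (1 : ℝ) ≤ s := by exact_mod_cast hs
  have hn' : (1 : ℝ) ≤ n := by exact_mod_cast hn
  have hnd' : (n : ℝ) ≤ d := by exact_mod_cast hnd
  have hs0 : (0 : ℝ) < s := by linarith
  have h2 := log_two_le_rate hs hsd hT
  have h1 : Real.log s ≤ s * Real.log 2 := by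
    rw [← Real.log_pow]
    refine Real.log_le_log hs0 ?_
    exact_mod_cast (Nat.lt_two_pow_self (n := s)).le
  have h0 : 0 ≤ Real.log (T / s) := by
    have := Real.log_pos one_lt_two
    nlinarith
  have h3 : Real.log n ≤ Real.log s + Real.log (T / s) := by
    have hTpos : 0 < T := by linarith
    rw [← Real.log_mul hs0.ne' (by positivity), mul_div_cancel₀ _ hs0.ne']
    exact Real.log_le_log (by linarith) (by linarith)
  nlinarith

/-- Concavity of `log` over the support: the arguments sum to at most `s + ‖θ₀‖₁ / τ ≤ C₁ / τ`. The
tangent is taken at `A = C₁ / (τ s)`. -/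
lemma sum_log_le_rate {τ C₁ : ℝ} (hτ : 0 < τ) (θ₀ : EuclideanSpace ℝ (Fin d))
    (hs : 1 ≤ l0norm θ₀) (hC : l1norm θ₀ ≤ C₁ - 2 * d * τ) :
    ∑ i with θ₀ i ≠ 0, Real.log (1 + |θ₀ i| / τ)
      ≤ l0norm θ₀ * Real.log (C₁ / τ / l0norm θ₀) := by
  have hcard := l0norm_eq_card θ₀
  set s := l0norm θ₀ with hsdef
  have hs' : (0 : ℝ) < s := by exact_mod_cast hs
  have hsd : (s : ℝ) ≤ d := by
    have := Finset.card_le_univ (Finset.univ.filter fun i => θ₀ i ≠ 0)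
    rw [← hcard, Fintype.card_fin] at this
    exact_mod_cast this
  have hl1 : 0 ≤ l1norm θ₀ := Finset.sum_nonneg fun _ _ => abs_nonneg _
  have hT : l1norm θ₀ / τ + 2 * d ≤ C₁ / τ := by
    rw [le_div_iff₀ hτ, add_mul, div_mul_cancel₀ _ hτ.ne']; linarith
  have hT0 : 0 < C₁ / τ := by
    have : 0 ≤ l1norm θ₀ / τ := by positivity
    linarith
  set A := C₁ / τ / s with hA
  have hA0 : 0 < A := by positivity
  have htan : ∀ x : ℝ, 0 < x → Real.log x ≤ x / A + Real.log A - 1 := by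
    intro x hx
    have := Real.log_le_sub_one_of_pos (div_pos hx hA0)
    rw [Real.log_div hx.ne' hA0.ne'] at this
    linarith
  have hsum : ∑ i with θ₀ i ≠ 0, (1 + |θ₀ i| / τ) ≤ C₁ / τ := by
    rw [Finset.sum_add_distrib, ← Finset.sum_div, Finset.sum_const, ← hcard]
    have : ∑ i with θ₀ i ≠ 0, |θ₀ i| ≤ l1norm θ₀ :=
      Finset.sum_le_sum_of_subset_of_nonneg (Finset.filter_subset _ _) fun _ _ _ => abs_nonneg _
    have : (∑ i with θ₀ i ≠ 0, |θ₀ i|) / τ ≤ l1norm θ₀ / τ := by gcongr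
    simp only [nsmul_eq_mul, mul_one]
    linarith
  calc ∑ i with θ₀ i ≠ 0, Real.log (1 + |θ₀ i| / τ)
      ≤ ∑ i with θ₀ i ≠ 0, ((1 + |θ₀ i| / τ) / A + (Real.log A - 1)) :=
        Finset.sum_le_sum fun i _ => by linarith [htan (1 + |θ₀ i| / τ) (by positivity)]
    _ = (∑ i with θ₀ i ≠ 0, (1 + |θ₀ i| / τ)) / A + s * (Real.log A - 1) := by
        rw [Finset.sum_add_distrib, ← Finset.sum_div, Finset.sum_const, ← hcard, nsmul_eq_mul]
    _ ≤ C₁ / τ / A + s * (Real.log A - 1) := by gcongr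
    _ = s * Real.log A := by rw [hA, div_div_cancel₀ hT0.ne']; ring

lemma neg_log_theta_mass_le {τ C₁ : ℝ} (hτ : 0 < τ) (θ₀ : EuclideanSpace ℝ (Fin d))
    (hs : 1 ≤ l0norm θ₀) (hC : l1norm θ₀ ≤ C₁ - 2 * d * τ) :
    -Real.log (3 / 4 * ∏ i with θ₀ i ≠ 0, ((2 * (1 + |θ₀ i| / τ) ^ 2) ^ 2)⁻¹)
      ≤ Real.log 2 + 2 * (l0norm θ₀ * Real.log 2)
        + 4 * (l0norm θ₀ * Real.log (C₁ / τ / l0norm θ₀)) := by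
  have hpos : ∀ i, 0 < ((2 * (1 + |θ₀ i| / τ) ^ 2) ^ 2)⁻¹ := fun i => by positivity
  have hlog : ∀ i, Real.log (((2 * (1 + |θ₀ i| / τ) ^ 2) ^ 2)⁻¹)
      = -(2 * Real.log 2 + 4 * Real.log (1 + |θ₀ i| / τ)) := by
    intro i
    have : 0 < 1 + |θ₀ i| / τ := by positivity
    rw [Real.log_inv, Real.log_pow, Real.log_mul two_ne_zero (by positivity), Real.log_pow]
    push_cast
    ring
  rw [Real.log_mul (by norm_num) (Finset.prod_pos fun i _ => hpos i).ne',
    Real.log_prod fun i _ => (hpos i).ne']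
  simp_rw [hlog]
  rw [Finset.sum_neg_distrib, Finset.sum_add_distrib, ← Finset.mul_sum, ← Finset.mul_sum,
    Finset.sum_const, ← l0norm_eq_card, nsmul_eq_mul]
  have h1 := sum_log_le_rate hτ θ₀ hs hC
  have h2 : -Real.log (3 / 4) ≤ Real.log 2 := by
    rw [← Real.log_inv]
    exact Real.log_le_log (by norm_num) (by norm_num)
  linarith

/-- In the coefficient of `log n`, the scale `b = n^(-1/2)` contributes `a / 2` and the interval
length `σ₀² / n` contributes `1`. All else is bounded by the range of `σ₀²`, using `t² ≤ 2σ₀²`. -/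
lemma neg_log_sigma_mass_le {a σmin σmax σ₀ t : ℝ} {n : ℕ} (ha : 0 < a) (hσmin : 0 < σmin)
    (hσmax : 0 < σmax) (hσ₀ : 0 < σ₀) (h1 : (2 * σmin)⁻¹ < σ₀ ^ 2) (h2 : σ₀ ^ 2 < (2 * σmax)⁻¹)
    (hn : 1 ≤ n) (ht : t = σ₀ * √(1 + 1 / n)) :
    0 < (1 / √(n : ℝ)) ^ a / Real.Gamma a * (t ^ 2) ^ (-a - 1) * Real.exp (-(1 / √(n : ℝ)) / σ₀ ^ 2)
        * (t ^ 2 - σ₀ ^ 2) ∧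
    -Real.log ((1 / √(n : ℝ)) ^ a / Real.Gamma a * (t ^ 2) ^ (-a - 1)
        * Real.exp (-(1 / √(n : ℝ)) / σ₀ ^ 2) * (t ^ 2 - σ₀ ^ 2))
      ≤ (a / 2 + 1) * Real.log n + (Real.log (Real.Gamma a) - (a + 1) * Real.log σmax
        + 2 * σmin + Real.log (2 * σmin)) := by
  have hn' : (1 : ℝ) ≤ n := by exact_mod_cast hn
  have hn0 : (0 : ℝ) < n := by linarith
  have hΓ := Real.Gamma_pos_of_pos ha
  have hs2 : 0 < σ₀ ^ 2 := by positivity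
  have ht2 : t ^ 2 = σ₀ ^ 2 * (1 + 1 / n) := by
    rw [ht, mul_pow, Real.sq_sqrt (by positivity)]
  have ht0 : 0 < t ^ 2 := by rw [ht2]; positivity
  have hdiff : t ^ 2 - σ₀ ^ 2 = σ₀ ^ 2 / n := by rw [ht2]; ring
  have hb : 0 < 1 / √(n : ℝ) := by positivity
  have hb1 : 1 / √(n : ℝ) ≤ 1 := by
    rw [div_le_one (by positivity)]; exact Real.one_le_sqrt.2 hn'
  rw [hdiff]
  refine ⟨by positivity, ?_⟩
  rw [Real.log_mul (by positivity) (by positivity), Real.log_mul (by positivity) (by positivity),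
    Real.log_mul (by positivity) (by positivity), Real.log_div (by positivity) hΓ.ne',
    Real.log_div hs2.ne' hn0.ne', Real.log_exp, Real.log_rpow hb, Real.log_rpow ht0, one_div,
    Real.log_inv, Real.log_sqrt hn0.le]
  have e1 : Real.log (t ^ 2) ≤ -Real.log σmax := by
    rw [← Real.log_inv]
    refine Real.log_le_log ht0 ?_
    have : 1 / (n : ℝ) ≤ 1 := by rw [div_le_one hn0]; exact hn'
    have e : σmax⁻¹ = (2 * σmax)⁻¹ * 2 := by field_simp
    rw [ht2, e]
    gcongr
    linarith
  have e2 : (√(n : ℝ))⁻¹ / σ₀ ^ 2 ≤ 2 * σmin := by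
    rw [div_le_iff₀ hs2]
    rw [one_div] at hb1
    rw [inv_lt_iff_one_lt_mul₀ (by positivity)] at h1
    linarith
  have e3 : -Real.log (σ₀ ^ 2) ≤ Real.log (2 * σmin) := by
    rw [neg_le, ← Real.log_inv]
    exact Real.log_le_log (by positivity) h1.le
  have e4 : (a + 1) * Real.log (t ^ 2) ≤ (a + 1) * -Real.log σmax := by gcongr
  rw [neg_div]
  linarith

end Mass

/-! ### Assembly of the oracle bound and the prior mass bounds. -/

lemma isFiniteMeasure_of_univ_le_one {S : Type*} [MeasurableSpace S] {μ : Measure S}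
    (h : μ Set.univ ≤ 1) : IsFiniteMeasure μ :=
  ⟨h.trans_lt ENNReal.one_lt_top⟩

lemma l0norm_le {d : ℕ} (θ : EuclideanSpace ℝ (Fin d)) : l0norm θ ≤ d := by
  rw [l0norm_eq_card]
  simpa using Finset.card_le_univ (Finset.univ.filter fun i => θ i ≠ 0)

end FracPost

open FracPost in
theorem mainTheorem3 (a σmin σmax : ℝ) (ha : 0 < a) (hσmin : 0 < σmin) (hσmax : 0 < σmax) :
    ∃ c : ℝ, 0 < c ∧
      ∀ (α : ℝ), 0 < α → α < 1 →
      ∀ (n d : ℕ) (Cx C₁ σ₀ τ : ℝ)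
        (Q : Measure (EuclideanSpace ℝ (Fin d))) (θ₀ : EuclideanSpace ℝ (Fin d)),
        IsProbabilityMeasure Q →
        0 < Cx →
        ∫⁻ x, ‖x‖ₑ ^ 2 ∂Q < ENNReal.ofReal (Cx ^ 2) →
        0 < σ₀ →
        (2 * σmin)⁻¹ < σ₀ ^ 2 →
        σ₀ ^ 2 < (2 * σmax)⁻¹ →
        1 ≤ l0norm θ₀ →
        l0norm θ₀ < n →
        n < d →
        τ = 1 / (Cx * √((n : ℝ) * d)) →
        l1norm θ₀ ≤ C₁ - 2 * d * τ →
        ∫⁻ z, ∫⁻ p, renyiDiv α (modelLaw Q p.1 p.2) (modelLaw Q θ₀ σ₀)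
            ∂(fracPosterior α (prior d C₁ τ a (1 / √(n : ℝ))) z)
          ∂(Measure.pi (fun _ : Fin n => modelLaw Q θ₀ σ₀))
        ≤ ENNReal.ofReal ((1 + α) / (1 - α) *
            (c * (l0norm θ₀ : ℝ) *
              Real.log (Cx * C₁ * √((n : ℝ) * d) / (l0norm θ₀ : ℝ)) / n)) := by
  set K := Real.log (Real.Gamma a) - (a + 1) * Real.log σmax + 2 * σmin + Real.log (2 * σmin)
    with hK
  have hlog2 : 0 < Real.log 2 := Real.log_pos one_lt_two
  -- `7 = 1 + 2 + 4` collects the three terms of `neg_log_theta_mass_le`; `a + 2` comes from `(a / 2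
  -- + 1) log n` with `log n ≤ 2L`; `K` is the constant of `neg_log_sigma_mass_le`.
  set c₁ := 7 + (a + 2) + |K| / Real.log 2 with hc₁
  -- `c₂` pays for the Kullback–Leibler type term.
  set c₂ := (1 / 2 + 4 * σmin) / Real.log 2 with hc₂
  have hc₁0 : 0 < c₁ := by positivity
  have hc₂0 : 0 < c₂ := by positivity
  refine ⟨c₁ + c₂, by positivity, ?_⟩
  intro α hα0 hα1 n d Cx C₁ σ₀ τ Q θ₀ hQp hCx hQ hσ₀ hσ1 hσ2 hs hsn hnd hτ hC
  have hα1' : 0 < 1 - α := by linarith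
  have hn1 : 1 ≤ n := by omega
  have hn' : (1 : ℝ) ≤ n := by exact_mod_cast hn1
  have hn0 : (0 : ℝ) < n := by linarith
  have hd0 : (0 : ℝ) < d := by
    have : 0 < d := by omega
    exact_mod_cast this
  have hτ0 : 0 < τ := by rw [hτ]; positivity
  have hb : 0 < 1 / √(n : ℝ) := by positivity
  -- the rate
  have hT : Cx * C₁ * √((n : ℝ) * d) / (l0norm θ₀ : ℝ) = C₁ / τ / l0norm θ₀ := by
    rw [hτ]; field_simp
  rw [hT]
  have h2d : 2 * (d : ℝ) ≤ C₁ / τ := by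
    have hl1 : 0 ≤ l1norm θ₀ := Finset.sum_nonneg fun _ _ => abs_nonneg _
    rw [le_div_iff₀ hτ0]; linarith
  set L := (l0norm θ₀ : ℝ) * Real.log (C₁ / τ / l0norm θ₀) with hL
  have hs' : (1 : ℝ) ≤ l0norm θ₀ := by exact_mod_cast hs
  have hL2 := log_two_le_rate hs (l0norm_le θ₀) h2d
  have hLn := log_le_rate hs (l0norm_le θ₀) hn1 hnd.le h2d
  rw [← hL] at hL2 hLn
  have hL1 : Real.log 2 ≤ L := by nlinarith
  have hL0 : 0 < L := by linarith
  -- Constants are absorbed into the rate because `L ≥ log 2`.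
  have hconst : ∀ x : ℝ, 0 ≤ x → x ≤ x / Real.log 2 * L := by
    intro x hx
    rw [div_mul_eq_mul_div, le_div_iff₀ hlog2]
    gcongr
  -- the prior
  have hπθ : priorTheta d C₁ τ Set.univ ≤ 1 := normalized_univ_le _
  have hπσ : priorSigma a (1 / √(n : ℝ)) Set.univ ≤ 1 := priorSigma_univ_le ha hb
  have := isFiniteMeasure_of_univ_le_one hπθ
  have := isFiniteMeasure_of_univ_le_one hπσ
  have hπ : prior d C₁ τ a (1 / √(n : ℝ)) Set.univ ≤ 1 := by
    rw [prior, ← Set.univ_prod_univ, Measure.prod_prod]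
    exact mul_le_one' hπθ hπσ
  have := isFiniteMeasure_of_univ_le_one hπ
  have hpos : ∀ᵐ p ∂prior d C₁ τ a (1 / √(n : ℝ)), 0 < p.2 :=
    Measure.quasiMeasurePreserving_snd.ae (priorSigma_ae_pos a (1 / √(n : ℝ)))
  -- the prior mass of the neighbourhood
  set r := 4 * d * τ ^ 2 with hr
  set t := σ₀ * √(1 + 1 / n) with ht
  have hσt : σ₀ ≤ t := le_mul_of_one_le_right hσ₀.le
    (Real.one_le_sqrt.2 (le_add_of_nonneg_right (by positivity)))
  set m₁ := 3 / 4 * ∏ i with θ₀ i ≠ 0, ((2 * (1 + |θ₀ i| / τ) ^ 2) ^ 2)⁻¹ with hm₁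
  set m₂ := (1 / √(n : ℝ)) ^ a / Real.Gamma a * (t ^ 2) ^ (-a - 1)
    * Real.exp (-(1 / √(n : ℝ)) / σ₀ ^ 2) * (t ^ 2 - σ₀ ^ 2) with hm₂
  have hm₁0 : 0 < m₁ := mul_pos (by norm_num) (Finset.prod_pos fun i _ => by positivity)
  obtain ⟨hm₂0, hm₂log⟩ := neg_log_sigma_mass_le ha hσmin hσmax hσ₀ hσ1 hσ2 hn1 ht
  rw [← hm₂] at hm₂0 hm₂log
  have hm₁log := neg_log_theta_mass_le hτ0 θ₀ hs hC
  rw [← hm₁, ← hL] at hm₁log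
  set B := {p : EuclideanSpace ℝ (Fin d) × ℝ |
      ‖p.1 - (θ₀, σ₀).1‖ ^ 2 ≤ r ∧ p.2 ∈ Set.Icc (θ₀, σ₀).2 ((θ₀, σ₀).2 * √(1 + 1 / (n : ℝ)))}
    with hB
  have hBprod : B = {θ | ‖θ - θ₀‖ ^ 2 ≤ r} ×ˢ Set.Icc σ₀ t := rfl
  have hmass : m₁ * m₂ ≤ (prior d C₁ τ a (1 / √(n : ℝ))).real B := by
    rw [Measure.real, ← ENNReal.ofReal_le_iff_le_toReal (measure_ne_top _ _), hBprod, prior,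
      Measure.prod_prod, ENNReal.ofReal_mul hm₁0.le]
    exact mul_le_mul' (le_priorTheta_ball hτ0 (by omega) θ₀ hC) (le_priorSigma_Icc ha hb hσ₀ hσt)
  have hB0 : 0 < (prior d C₁ τ a (1 / √(n : ℝ))).real B := (mul_pos hm₁0 hm₂0).trans_le hmass
  have hBlog : -Real.log ((prior d C₁ τ a (1 / √(n : ℝ))).real B) ≤ c₁ * L := by
    have h1 := Real.log_le_log (mul_pos hm₁0 hm₂0) hmass
    rw [Real.log_mul hm₁0.ne' hm₂0.ne'] at h1
    have h2 : (a / 2 + 1) * Real.log n ≤ (a / 2 + 1) * (2 * L) := by gcongr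
    have h3 := hconst |K| (abs_nonneg K)
    have h4 := le_abs_self K
    have h5 : c₁ * L = 7 * L + (a / 2 + 1) * (2 * L) + |K| / Real.log 2 * L := by
      rw [hc₁]; ring
    linarith
  -- the divergence term
  have hKL : n * (1 / (n : ℝ) / 2 + Cx ^ 2 * r / (2 * σ₀ ^ 2)) ≤ c₂ * L := by
    refine le_trans ?_ (hconst (1 / 2 + 4 * σmin) (by positivity))
    -- The choice of `τ` makes `r = 4 / (Cx² n)`, so `Cx`, `n` and `d` all cancel.
    have e : n * (1 / (n : ℝ) / 2 + Cx ^ 2 * r / (2 * σ₀ ^ 2)) = 1 / 2 + 2 * (σ₀ ^ 2)⁻¹ := by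
      rw [hr, hτ, div_pow, mul_pow, Real.sq_sqrt (by positivity)]
      field_simp
      ring
    have h6 : (σ₀ ^ 2)⁻¹ ≤ 2 * σmin := by
      rw [inv_le_comm₀ (by positivity) (by positivity)]
      exact hσ1.le
    rw [e]
    linarith
  refine (lintegral_renyiDiv_fracPosterior_le Q (p₀ := (θ₀, σ₀)) (by omega) hα0 hα1 hσ₀ hQ
    (prior d C₁ τ a (1 / √(n : ℝ))) hπ hpos (r := r) (δ := 1 / n) (by positivity)
    hB0).trans (ENNReal.ofReal_le_ofReal ?_)
  rw [← hB]
  have hfin : -Real.log ((prior d C₁ τ a (1 / √(n : ℝ))).real B)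
      + α * (n * (1 / (n : ℝ) / 2 + Cx ^ 2 * r / (2 * σ₀ ^ 2))) ≤ (1 + α) * ((c₁ + c₂) * L) := by
    have h7 := mul_le_mul_of_nonneg_left hKL hα0.le
    have h8 : 0 ≤ α * (c₁ * L) := by positivity
    have h9 : 0 ≤ c₂ * L := by positivity
    linarith
  calc _ ≤ (n * (1 - α))⁻¹ * ((1 + α) * ((c₁ + c₂) * L)) := by gcongr
    _ = _ := by rw [hL]; field_simp
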